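/- Let $G\subset \mathrm{PGL}(2,\mathbb Z)$ be a subgroup of finite index, $\mathbb P=\mathrm{PGL}(2,\mathbb Z)/G$, and $X_G=G\backslash\mathbb H=\mathrm{PGL}(2,\mathbb Z)\backslash(\mathbb H\times\mathbb P)$ (matrices of determinant $-1$ act on $\mathbb H$ by $z\mapsto (a\bar z+b)/(c\bar z+d)$). For $a,b\in\mathbb H\cup\mathbb P^1(\mathbb Q)$ let $\{a,b\}_G\in H_1(\overline{X_G},\mathbb R)$ be the class defined by integrating the lifts to $\mathbb H$ of the (real parts of the) differentials of the first kind along the geodesic arc from $a$ to $b$; more generally, for $t=gG\in\mathbb P$, the class of the image in $X_G$ of $\langle a,b\rangle\times\{t\}$ is $\{g^{-1}a,g^{-1}b\}_G$. Let $\beta\in\mathbb R$ be an irrational number whose continued fraction expansion $\beta=[a_0;a_1,a_2,\dots]$ is eventually periodic (a quadratic irrationality). Let $p_k/q_k$ be its convergents ($p_{-1}/q_{-1}=1/0$, $p_0/q_0=a_0/1$) and $$g_k(\beta)=\begin{pmatrix}p_{k-1}&p_k\\ q_{k-1}&q_k\end{pmatrix}.$$ Let $T(x,t)=\left(\frac1x-\left[\frac1x\right],\begin{pmatrix}-[1/x]&1\\1&0\end{pmatrix}t\right)$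 be the shift on $[0,1]\times\mathbb P$, fix $t=gG\in\mathbb P$ with $g\in\mathrm{GL}(2,\mathbb Z)$, and let $s_k=T^k(s_0)$ with $s_0=\left(\beta-[\beta],\,g_0(\beta)^{-1}t\right)$; thus $s_0=(\beta,t)$ if $\beta\in[0,1]$, and the second component of $s_k$ is $g_k^{-1}(\beta)\,t$. Then: 1. The Lyapunov exponent $\lambda(\beta)=\lim_{n\to\infty}\frac1n\log|(T^n)'(\beta-[\beta])|$ of the shift $x\mapsto 1/x-[1/x]$ exists and is positive, and there are integers $m\ge 0$, $\ell\ge 1$ with $s_{m+\ell}=s_m$. 2. The limiting modular symbol of $\beta$ on the sheet $t$ exists: there is a class $\{\{*,\beta\}\}_{G}\in H_1(\overline{X_G},\mathbb R)$ such that, for every geodesic in $\mathbb H$ with one end at $\beta$, every $x_0$ on it and every $x\in\mathbb H$ (for example $x=x_0$), if $y(\tau)$ denotes the point of the geodesic at hyperbolic distance $\tau$ from $x_0$ towards $\beta$, then $$\lim_{\tau\to\infty}\frac1\tau\,\{g^{-1}x,g^{-1}y(\tau)\}_G=\{\{*,\beta\}\}_{G}.$$ (For the base point $t=G$, $g=1$,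 this is $\lim\frac1\tau\{x,y(\tau)\}_G$.) 3. For all integers $m\ge0$, $\ell\ge1$ with $s_{m+\ell}=s_m$, $$\{\{*,\beta\}\}_{G}=\frac{1}{\lambda(\beta)\,\ell}\sum_{k=m+1}^{m+\ell}\left\{g^{-1}\!\left(\frac{p_{k-1}}{q_{k-1}}\right),\,g^{-1}\!\left(\frac{p_{k}}{q_{k}}\right)\right\}_G .$$ In particular, if $\beta\in[0,1]$ and $T^\ell(\beta,t)=(\beta,t)$, the sum may be taken over $k=1,\dots,\ell$. -/

import Mathlib

open Filter Topology MeasureTheory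
open scoped MatrixGroups

noncomputable section

namespace LimSymb

/-! ### Continued fractions and the shift -/

/-- The shift of the continued fraction expansion, `x ↦ 1/x - [1/x]`, on `[0,1]`
(with the value `0` at `0`). -/
def gaussMap (x : ℝ) : ℝ := 1 / x - ⌊1 / x⌋

/-- The partial quotients of `β = [a₀; a₁, a₂, …]`: `a₀ = [β]` and `a_{k+1} = [1 / Tᵏ{β}]`,
where `{β}` is the fractional part and `T` is the shift. -/
def cfDigit (β : ℝ) : ℕ → ℤ
  | 0 => ⌊β⌋
  | k + 1 => ⌊1 / gaussMap^[k] (Int.fract β)⌋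

/-- The partial quotients of `β` are eventually periodic. -/
def EventuallyPeriodicCF (β : ℝ) : Prop :=
  ∃ N d : ℕ, 0 < d ∧ ∀ k, N ≤ k → cfDigit β (k + d) = cfDigit β k

/-- The integral matrix `(0 1; 1 a)`. -/
def cfStep (a : ℤ) : GL (Fin 2) ℤ where
  val := !![0, 1; 1, a]
  inv := !![-a, 1; 1, 0]
  val_inv := by ext i j; fin_cases i <;> fin_cases j <;> simp [Matrix.mul_apply]
  inv_val := by ext i j; fin_cases i <;> fin_cases j <;> simp [Matrix.mul_apply]

/-- The integral matrix `(1 a; 0 1)`. -/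
def cfTranslate (a : ℤ) : GL (Fin 2) ℤ where
  val := !![1, a; 0, 1]
  inv := !![1, -a; 0, 1]
  val_inv := by ext i j; fin_cases i <;> fin_cases j <;> simp [Matrix.mul_apply]
  inv_val := by ext i j; fin_cases i <;> fin_cases j <;> simp [Matrix.mul_apply]

/-- The matrix `g_k(β) = (p_{k-1} p_k; q_{k-1} q_k)` of successive convergents of `β`, starting
from `p_{-1}/q_{-1} = 1/0` and `p_0/q_0 = [β]/1`; multiplication by `(0 1; 1 a_{k+1})` is the
recursion `p_{k+1} = a_{k+1} p_k + p_{k-1}`, `q_{k+1} = a_{k+1} q_k + q_{k-1}`. -/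
def cfMatrix (β : ℝ) : ℕ → GL (Fin 2) ℤ
  | 0 => cfTranslate (cfDigit β 0)
  | k + 1 => cfMatrix β k * cfStep (cfDigit β (k + 1))

/-- `lam` is the Lyapunov exponent of the shift at `x`:
`lam = lim (1/n) log |(Tⁿ)'(x)|` (the limit exists and equals `lam`). -/
def IsLyapunovExponent (x lam : ℝ) : Prop :=
  Tendsto (fun n : ℕ => 1 / (n : ℝ) * Real.log |deriv (gaussMap^[n]) x|) atTop (𝓝 lam)

/-- The coset space `ℙ = PGL(2,ℤ)/G`. -/
abbrev Cosets (G : Subgroup PGL(2, ℤ)) : Type := PGL(2, ℤ) ⧸ G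

/-- The shift on `[0,1] × ℙ`,
`T(x,t) = (1/x - [1/x], (-[1/x] 1; 1 0) t)`; the matrix is the inverse of `(0 1; 1 [1/x])`. -/
def shift (G : Subgroup PGL(2, ℤ)) (s : ℝ × Cosets G) : ℝ × Cosets G :=
  (gaussMap s.1, Matrix.ProjGenLinGroup.mk (cfStep ⌊1 / s.1⌋)⁻¹ • s.2)

/-- The point of `[0,1] × ℙ` attached to a real `β` and `t = gG ∈ ℙ`. For `β ∈ [0,1)` it is
`(β, t)`; in general it is the translate of `(β, t)` by `-[β]`. -/
def startPoint (G : Subgroup PGL(2, ℤ)) (g : GL (Fin 2) ℤ) (β : ℝ) : ℝ × Cosets G :=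
  (Int.fract β, Matrix.ProjGenLinGroup.mk (cfTranslate ⌊β⌋)⁻¹ •
    (QuotientGroup.mk (Matrix.ProjGenLinGroup.mk g) : Cosets G))

/-! ### The completed half plane and integrals along geodesic arcs -/

/-- `ℍ ∪ P¹(ℚ)`. -/
abbrev HBar : Type := UpperHalfPlane ⊕ OnePoint ℚ

/-- `ℍ ∪ P¹(ℚ)` as a subset of the Riemann sphere. -/
def HBar.toSphere : HBar → OnePoint ℂ
  | .inl z => ((z : ℂ) : OnePoint ℂ)
  | .inr c => OnePoint.map (fun q : ℚ => (q : ℂ)) c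

/-- The action of `GL(2,ℤ)` on `ℍ ∪ P¹(ℚ)` by fractional linear transformations; a matrix of
determinant `-1` acts on `ℍ` by `z ↦ (a z̄ + b)/(c z̄ + d)`. -/
def HBar.act (g : GL (Fin 2) ℤ) : HBar → HBar
  | .inl z => .inl (Matrix.GeneralLinearGroup.map (Int.castRingHom ℝ) g • z)
  | .inr c => .inr (Matrix.GeneralLinearGroup.map (Int.castRingHom ℚ) g • c)

/-- The integral of `f(z) dz` along the vertical segment (or half line) of points `x + i t` with
`t` in `s`, in the upward direction. -/
def verticalIntegral (f : UpperHalfPlane → ℂ) (x : ℝ) (s : Set ℝ) : ℂ :=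
  ∫ t in s, f (UpperHalfPlane.ofComplex (x + t * Complex.I)) * Complex.I

/-- The integral of `f(z) dz` along the geodesic arc from `a` to `b`, for `a, b` in the closed
upper half plane or equal to `∞`. The arc lies on a vertical line if one of the ends is `∞`
or the real parts agree; otherwise it is an arc of the circle `c + r e^{iθ}` that passes through
`a` and `b` and has its centre `c` on the real axis. -/
def arcIntegral (f : UpperHalfPlane → ℂ) (a b : OnePoint ℂ) : ℂ :=
  match a, b with
  | .infty, .infty => 0
  | .some a, .infty => verticalIntegral f a.re (Set.Ioi a.im)
  | .infty, .some b => -verticalIntegral f b.re (Set.Ioi b.im)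
  | .some a, .some b =>
    if a.re = b.re then
      verticalIntegral f a.re (Set.Ioc a.im b.im) - verticalIntegral f a.re (Set.Ioc b.im a.im)
    else
      let c : ℝ := (Complex.normSq b - Complex.normSq a) / (2 * (b.re - a.re))
      let r : ℝ := ‖a - c‖
      ∫ θ in (a - c).arg..(b - c).arg,
        f (UpperHalfPlane.ofComplex (c + r * Complex.exp (θ * Complex.I))) *
          (r * Complex.I * Complex.exp (θ * Complex.I))

/-! ### Homology of the modular curve and modular symbols -/

/-- The preimage in `GL(2,ℤ)` of `G ⊆ PGL(2,ℤ)`, as a subgroup of `GL(2,ℝ)`. -/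
def realGroup (G : Subgroup PGL(2, ℤ)) : Subgroup (GL (Fin 2) ℝ) :=
  (G.comap (Matrix.ProjGenLinGroup.mk : GL (Fin 2) ℤ →* PGL(2, ℤ))).map
    (Matrix.GeneralLinearGroup.map (Int.castRingHom ℝ))

/-- The lifts `f(z) dz` to `ℍ` of the differentials of the first kind on the modular curve
`X_G = G \ ℍ = PGL(2,ℤ) \ (ℍ × ℙ)`, i.e. the cusp forms `f` of weight two for `G`.
If `γ ∈ G` has determinant `-1`, then `γ` acts on `ℍ` antiholomorphically and the condition
`f ∣[2] γ = f` says that `γ^*(f dz)` is minus the complex conjugate of `f dz`. So in all cases the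
real harmonic form `Im (f dz)` is `G`-invariant, and these are all the real harmonic one-forms on
the compactification of `X_G`. -/
abbrev FirstKind (G : Subgroup PGL(2, ℤ)) : Type := CuspForm (realGroup G) 2

/-- `H₁(X_G, ℝ)` for the compactified modular curve: a real homology class is the real linear
functional given by integrating the real harmonic forms `Im (f dz)` along it. For
`G ⊆ PSL(2,ℤ)`, where `i f` is a cusp form if `f` is, such a functional `u` and the complex
period functional `f ↦ u (i f) + i u f` (integration of `f dz`) determine each other. -/
abbrev H1 (G : Subgroup PGL(2, ℤ)) : Type := Module.Dual ℝ (FirstKind G)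

/-- The modular symbol `{a, b}_G` for `a, b ∈ ℍ ∪ P¹(ℚ)`, through its pairing with the forms
`Im (f dz)`. -/
def modularSymbol (G : Subgroup PGL(2, ℤ)) (a b : HBar) (f : FirstKind G) : ℝ :=
  (arcIntegral f a.toSphere b.toSphere).im

/-- The class in `X_G = PGL(2,ℤ) \ (ℍ × ℙ)` of the image of the arc `⟨a, b⟩ × {gG}`. Since the point
`(z, gG)` is equivalent to `(g⁻¹ z, G)`, this is `{g⁻¹ a, g⁻¹ b}_G`. For `g = 1` it is
`{a, b}_G`. -/
def sheetSymbol (G : Subgroup PGL(2, ℤ)) (g : GL (Fin 2) ℤ) (a b : HBar) (f : FirstKind G) : ℝ :=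
  modularSymbol G (HBar.act g⁻¹ a) (HBar.act g⁻¹ b) f

/-- The geodesic of `ℍ` with the distinct ends `α ∈ P¹(ℝ)` and `β ∈ ℝ`: a vertical line, or the
half circle on the diameter from `α` to `β`. -/
def geodesicLine (α : OnePoint ℝ) (β : ℝ) : Set UpperHalfPlane :=
  match α with
  | .infty => {z | z.re = β}
  | .some α => {z | (z.re - α) * (z.re - β) + z.im ^ 2 = 0}

/-- `c ∈ H₁(X_G, ℝ)` is the limiting modular symbol at `β` on the sheet `gG`
(for `g = 1`: the limiting modular symbol `{{*, β}}_G`): for every geodesic with an end at `β`, every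
point `x₀` on it, every `x ∈ ℍ` (for instance `x = x₀`), and `y(τ)` the point of the geodesic
at hyperbolic distance `τ` from `x₀` towards `β`, the classes of `⟨x, y(τ)⟩ × {gG}` divided by `τ`
tend to `c`. (As `H₁` is finite dimensional, its topology is that of pointwise convergence.) -/
def IsLimitingModularSymbol (G : Subgroup PGL(2, ℤ)) (g : GL (Fin 2) ℤ) (β : ℝ) (c : H1 G) :
    Prop :=
  ∀ (α : OnePoint ℝ) (x x₀ : UpperHalfPlane) (y : ℝ → UpperHalfPlane),
    α ≠ (β : OnePoint ℝ) → x₀ ∈ geodesicLine α β →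
    (∀ τ : ℝ, 0 ≤ τ → y τ ∈ geodesicLine α β ∧ dist x₀ (y τ) = τ) →
    Tendsto (fun τ => (y τ : ℂ)) atTop (𝓝 (β : ℂ)) →
    ∀ f : FirstKind G,
      Tendsto (fun τ : ℝ => 1 / τ * sheetSymbol G g (.inl x) (.inl (y τ)) f) atTop (𝓝 (c f))

/-- The convergent `p_k/q_k = g_k(β)(0)` of `β`, as a cusp. -/
def convergent (β : ℝ) (k : ℕ) : HBar := HBar.act (cfMatrix β k) (.inr ((0 : ℚ) : OnePoint ℚ))

end LimSymb

end

noncomputable section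

namespace LimSymb

open UpperHalfPlane ModularForm
open scoped ComplexConjugate Manifold Pointwise

/-! ### Primitives on the upper half plane -/

/-! Fix a form `f` and a primitive `F` of it on the half plane. Every symbol paired with `f` is a
difference of values of `Im F`, with limits of `F` taken at cusps, and each element of `G`, also of
determinant `-1`, changes `Im F` by a constant.

Let `s_{m+l} = s_m`. The matrix `h = g_{m+l} g_m⁻¹` (`periodMatrix`) has eigenvector `(β, 1)` with
eigenvalue `μ > 1`, the product of the `1/x_j` over one period of the orbit, and equality of the
sheets says that `g⁻¹ h g` lies in `G` (`iterate_shift_eq_iff`, `mulVec_periodMatrix`). Hence `Im F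
∘ g⁻¹` gains a constant `P` under `h`. In the coordinate `1/(β - z)` the inverse of `h` is a
contraction fixing `∞` with multiplier `± μ⁻²`, and a geodesic towards `β` is a vertical line with
height proportional to `e^τ`. So the symbol grows like `τ P / (2 log μ)`
(`tendsto_of_quasiperiodic`, `tendsto_sheetSymbol`).

The chain rule gives `|(Tⁿ)'| = ∏ x_j⁻²`, so the same product yields `λ l = 2 log μ`
(`isLyapunovExponent_of_periodic`). The symbols of successive convergents telescope to the arc from
`p_m/q_m` to `h(p_m/q_m) = p_{m+l}/q_{m+l}`, whose integral is `P` (`sum_sheetSymbol_convergent`).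
Together these give the formula. A period exists by the pigeonhole principle, since `ℙ` is finite.
-/

/-- `F` is a primitive of `f` on the upper half plane. -/
def IsPrimitive (F : ℂ → ℂ) (f : ℍ → ℂ) : Prop :=
  ∀ z : ℍ, HasDerivAt F (f z) z

lemma exists_isPrimitive {f : ℍ → ℂ} (hf : MDiff f) : ∃ F, IsPrimitive F f := by
  have hf' := UpperHalfPlane.mdifferentiable_iff.mp hf
  -- Cayley transform from the unit disc to the half plane
  have him : ∀ w ∈ Metric.ball (0 : ℂ) 1, 0 < (Complex.I * (1 + w) / (1 - w)).im := by
    intro w hw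
    have h1 : Complex.normSq w < 1 := by
      rw [Complex.normSq_eq_norm_sq]
      have : ‖w‖ < 1 := by simpa using hw
      nlinarith [norm_nonneg w]
    have hne : 1 - w ≠ 0 := by
      intro h
      have : w = 1 := by linear_combination -h
      simp [this] at h1
    have hpos : 0 < Complex.normSq (1 - w) := Complex.normSq_pos.mpr hne
    have : (Complex.I * (1 + w) / (1 - w)).im = (1 - Complex.normSq w) / Complex.normSq (1 - w) := by
      rw [Complex.div_im]
      simp [Complex.normSq_apply]
      ring
    rw [this]
    exact div_pos (by linarith) hpos
  have hne : ∀ w ∈ Metric.ball (0 : ℂ) 1, 1 - w ≠ 0 := by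
    intro w hw h
    have : w = 1 := by linear_combination -h
    simp [this] at hw
  -- The factor `2i/(1 - w)²` is the derivative of `w ↦ i(1 + w)/(1 - w)`: this is the pullback of
  -- `f dz` to the disc, where holomorphic functions have primitives.
  have hg : DifferentiableOn ℂ
      (fun w => (f ∘ ofComplex) (Complex.I * (1 + w) / (1 - w)) * (2 * Complex.I / (1 - w) ^ 2))
      (Metric.ball 0 1) := by
    refine DifferentiableOn.mul ?_ ?_
    · refine DifferentiableOn.comp (g := f ∘ ofComplex) (t := {z | 0 < z.im}) hf' ?_ him
      refine DifferentiableOn.div (by fun_prop) (by fun_prop) hne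
    · refine DifferentiableOn.div (by fun_prop) (by fun_prop) fun w hw => pow_ne_zero 2 (hne w hw)
  obtain ⟨H, hH⟩ := hg.isExactOn_ball
  refine ⟨fun z => H ((z - Complex.I) / (z + Complex.I)), fun z => ?_⟩
  have hz : (z : ℂ) + Complex.I ≠ 0 := by
    intro h
    have := congrArg Complex.im h
    simp at this
    linarith [z.im_pos]
  have hball : ((z : ℂ) - Complex.I) / (z + Complex.I) ∈ Metric.ball (0 : ℂ) 1 := by
    rw [mem_ball_zero_iff, norm_div, div_lt_one (norm_pos_iff.mpr hz)]
    rw [← sq_lt_sq₀ (norm_nonneg _) (norm_nonneg _), ← Complex.normSq_eq_norm_sq,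
      ← Complex.normSq_eq_norm_sq, Complex.normSq_apply, Complex.normSq_apply]
    simp
    nlinarith [z.im_pos]
  have hd : HasDerivAt (fun z : ℂ => (z - Complex.I) / (z + Complex.I))
      (2 * Complex.I / ((z : ℂ) + Complex.I) ^ 2) z := by
    convert! ((hasDerivAt_id (z : ℂ)).sub_const Complex.I).div
      ((hasDerivAt_id (z : ℂ)).add_const Complex.I) hz using 1
    simp
    ring
  have := (hH _ hball).comp (z : ℂ) hd
  convert! this using 1
  have hone : (1 - ((z : ℂ) - Complex.I) / (z + Complex.I)) = 2 * Complex.I / (z + Complex.I) := by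
    field_simp; ring
  have hinv : Complex.I * (1 + ((z : ℂ) - Complex.I) / (z + Complex.I)) /
      (1 - ((z : ℂ) - Complex.I) / (z + Complex.I)) = z := by
    rw [hone]
    field_simp
    ring
  beta_reduce
  rw [hinv, Function.comp_apply, ofComplex_apply, hone]
  field_simp [Complex.I_ne_zero]

namespace IsPrimitive

variable {F : ℂ → ℂ} {f : ℍ → ℂ}

lemma add {F' : ℂ → ℂ} {f' : ℍ → ℂ} (h : IsPrimitive F f) (h' : IsPrimitive F' f') :
    IsPrimitive (F + F') (f + f') := fun z => (h z).add (h' z)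

lemma real_smul (h : IsPrimitive F f) (r : ℝ) : IsPrimitive (r • F) (r • f) :=
  fun z => (h z).const_smul r

lemma hasDerivAt_comp (h : IsPrimitive F f) {p : ℝ → ℂ} {p' : ℂ} {t : ℝ}
    (hp : HasDerivAt p p' t) (him : 0 < (p t).im) :
    HasDerivAt (fun s => F (p s)) (f (ofComplex (p t)) * p') t := by
  have h1 : HasDerivAt F (f (ofComplex (p t))) (p t) := by
    have := h ⟨p t, him⟩
    rwa [ofComplex_apply_of_im_pos him]
  have := h1.scomp t hp
  rw [smul_eq_mul, mul_comm] at this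
  exact this

lemma continuous_comp_coe (h : IsPrimitive F f) : Continuous fun z : ℍ => F z :=
  continuous_iff_continuousAt.mpr fun z =>
    ContinuousAt.comp (f := fun z : ℍ => (z : ℂ)) (h z).continuousAt continuous_coe.continuousAt

lemma sub_eq_sub_of_same (h : IsPrimitive F f) {F' : ℂ → ℂ} (h' : IsPrimitive F' f) (z w : ℍ) :
    F z - F w = F' z - F' w := by
  have hd : ∀ x ∈ {z : ℂ | 0 < z.im}, HasDerivWithinAt (fun z => F z - F' z) 0 {z : ℂ | 0 < z.im} x := by
    intro x hx
    have := ((h ⟨x, hx⟩).sub (h' ⟨x, hx⟩)).hasDerivWithinAt (s := {z : ℂ | 0 < z.im})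
    rw [sub_self] at this
    exact this
  have := (convex_halfSpace_im_gt 0).norm_image_sub_le_of_norm_hasDerivWithin_le (C := 0) hd
    (by simp) w.im_pos z.im_pos
  simp at this
  linear_combination sub_eq_zero.mp this

end IsPrimitive

lemma continuousOn_comp_ofComplex {X : Type*} [TopologicalSpace X] {f : ℍ → X} (hf : Continuous f) :
    ContinuousOn (fun z => f (ofComplex z)) {z : ℂ | 0 < z.im} := fun _ hz =>
  (hf.continuousAt.comp (mdifferentiableAt_ofComplex hz).continuousAt).continuousWithinAt

lemma verticalIntegral_Ioc {F : ℂ → ℂ} {f : ℍ → ℂ} (hF : IsPrimitive F f) (hf : Continuous f)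
    (x : ℝ) {s t : ℝ} (hs : 0 < s) (hst : s ≤ t) :
    verticalIntegral f x (Set.Ioc s t) = F (x + t * Complex.I) - F (x + s * Complex.I) := by
  rw [verticalIntegral, ← intervalIntegral.integral_of_le hst]
  have him : ∀ u : ℝ, ((x : ℂ) + u * Complex.I).im = u := by simp
  have hp : ∀ u : ℝ, HasDerivAt (fun u : ℝ => (x : ℂ) + u * Complex.I) Complex.I u := fun u => by
    simpa using ((Complex.ofRealCLM.hasDerivAt (x := u)).mul_const Complex.I).const_add (x : ℂ)
  refine intervalIntegral.integral_eq_sub_of_hasDerivAt (f := fun u : ℝ => F (x + u * Complex.I))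
    (fun u hu => hF.hasDerivAt_comp (hp u) ?_) ?_
  · rw [Set.uIcc_of_le hst] at hu
    rw [him]; linarith [hu.1]
  · refine ContinuousOn.intervalIntegrable ?_
    refine ContinuousOn.mul ?_ continuousOn_const
    refine (continuousOn_comp_ofComplex hf).comp (by fun_prop) fun u hu => ?_
    rw [Set.uIcc_of_le hst] at hu
    simp only [Set.mem_ofPred_eq, him]; linarith [hu.1]

lemma arg_mem_Ioo_of_im_pos {z : ℂ} (hz : 0 < z.im) : z.arg ∈ Set.Ioo 0 Real.pi := by
  refine ⟨lt_of_le_of_ne (Complex.arg_nonneg_iff.mpr hz.le) fun h => ?_,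
    lt_of_le_of_ne (Complex.arg_le_pi z) fun h => ?_⟩
  · have := (Complex.arg_eq_zero_iff.mp h.symm).2; linarith
  · have := (Complex.arg_eq_pi_iff.mp h).2; linarith

lemma hasDerivAt_circle (c r θ : ℝ) :
    HasDerivAt (fun θ : ℝ => (c : ℂ) + r * Complex.exp (θ * Complex.I))
      (r * Complex.I * Complex.exp (θ * Complex.I)) θ := by
  have h1 : HasDerivAt (fun θ : ℝ => (θ : ℂ) * Complex.I) Complex.I θ := by
    simpa using (Complex.ofRealCLM.hasDerivAt (x := θ)).mul_const Complex.I
  convert! (h1.cexp.const_mul (r : ℂ)).const_add (c : ℂ) using 1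
  ring

lemma im_circle (c r θ : ℝ) :
    ((c : ℂ) + r * Complex.exp (θ * Complex.I)).im = r * Real.sin θ := by
  simp [Complex.exp_ofReal_mul_I_im]

lemma re_circle (c r θ : ℝ) :
    ((c : ℂ) + r * Complex.exp (θ * Complex.I)).re = c + r * Real.cos θ := by
  simp [Complex.exp_ofReal_mul_I_re]

/-- The integral along a geodesic arc inside the half plane is the difference of the values of a
primitive. -/
lemma arcIntegral_coe {F : ℂ → ℂ} {f : ℍ → ℂ} (hF : IsPrimitive F f) (hf : Continuous f)
    (a b : ℍ) : arcIntegral f ((a : ℂ) : OnePoint ℂ) ((b : ℂ) : OnePoint ℂ) = F b - F a := by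
  have hcoe : ∀ z : ℍ, (z : ℂ) = (z.re : ℂ) + z.im * Complex.I := fun z => by
    simpa using (Complex.re_add_im (z : ℂ)).symm
  change (if (a : ℂ).re = (b : ℂ).re then _ else _) = _
  by_cases h : (a : ℂ).re = (b : ℂ).re
  · rw [if_pos h]
    have h' : a.re = b.re := h
    simp only [coe_re, coe_im]
    rcases le_total a.im b.im with hab | hab
    · rw [verticalIntegral_Ioc hF hf _ a.im_pos hab, Set.Ioc_eq_empty (not_lt.mpr hab)]
      simp only [verticalIntegral, Measure.restrict_empty, integral_zero_measure, sub_zero]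
      rw [← hcoe, h', ← hcoe]
    · rw [verticalIntegral_Ioc hF hf _ b.im_pos hab, Set.Ioc_eq_empty (not_lt.mpr hab)]
      simp only [verticalIntegral, Measure.restrict_empty, integral_zero_measure, zero_sub]
      rw [← hcoe, h', ← hcoe]
      ring
  · rw [if_neg h]
    have hne : b.re - a.re ≠ 0 := fun h' => h (by simp; linarith)
    generalize hc' : (Complex.normSq (b : ℂ) - Complex.normSq (a : ℂ)) /
      (2 * ((b : ℂ).re - (a : ℂ).re)) = c
    generalize hr' : ‖(a : ℂ) - c‖ = r
    have hr := hr'.symm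
    have hc : c = (b.re ^ 2 + b.im ^ 2 - a.re ^ 2 - a.im ^ 2) / (2 * (b.re - a.re)) := by
      simp only [← hc', Complex.normSq_apply, coe_re, coe_im]; congr 1; ring
    -- The centre is the real point equidistant from `a` and `b`, so the circle of radius `|a - c|`
    -- does end at `b`.
    have hrb : r = ‖(b : ℂ) - c‖ := by
      rw [hr, ← sq_eq_sq₀ (norm_nonneg _) (norm_nonneg _), ← Complex.normSq_eq_norm_sq,
        ← Complex.normSq_eq_norm_sq, Complex.normSq_apply, Complex.normSq_apply]
      simp only [Complex.sub_re, Complex.sub_im, coe_re, coe_im, Complex.ofReal_re,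
        Complex.ofReal_im, sub_zero]
      rw [hc]; field_simp; ring
    have ha0 : 0 < ((a : ℂ) - c).im := by simpa using a.im_pos
    have hb0 : 0 < ((b : ℂ) - c).im := by simpa using b.im_pos
    have hrpos : 0 < r := hr ▸ norm_pos_iff.mpr fun h0 => by simp [h0] at ha0
    have hpa : (c : ℂ) + r * Complex.exp (((a : ℂ) - c).arg * Complex.I) = a := by
      rw [hr, Complex.norm_mul_exp_arg_mul_I]; ring
    have hpb : (c : ℂ) + r * Complex.exp (((b : ℂ) - c).arg * Complex.I) = b := by
      rw [hrb, Complex.norm_mul_exp_arg_mul_I]; ring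
    have hpos : ∀ θ ∈ Set.uIcc ((a : ℂ) - c).arg ((b : ℂ) - c).arg,
        0 < ((c : ℂ) + r * Complex.exp (θ * Complex.I)).im := by
      intro θ hθ
      rw [im_circle]
      have := (Set.ordConnected_Ioo.uIcc_subset (arg_mem_Ioo_of_im_pos ha0)
        (arg_mem_Ioo_of_im_pos hb0)) hθ
      exact mul_pos hrpos (Real.sin_pos_of_pos_of_lt_pi this.1 this.2)
    rw [intervalIntegral.integral_eq_sub_of_hasDerivAt
      (f := fun θ : ℝ => F (c + r * Complex.exp (θ * Complex.I)))
      (fun θ hθ => hF.hasDerivAt_comp (hasDerivAt_circle c r θ) (hpos θ hθ)), hpa, hpb]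
    refine ContinuousOn.intervalIntegrable (ContinuousOn.mul ?_ (by fun_prop))
    exact (continuousOn_comp_ofComplex hf).comp (by fun_prop) hpos

/-! ### Primitives and the slash action -/

lemma hasDerivAt_num_div_denom (g : GL (Fin 2) ℝ) (z : ℍ) :
    HasDerivAt (fun z : ℂ => num g z / denom g z) (g.det.val / denom g z ^ 2) z := by
  have h1 : HasDerivAt (fun z : ℂ => num g z) (g 0 0 : ℂ) z := by
    simpa [num] using ((hasDerivAt_id (z : ℂ)).const_mul (g 0 0 : ℂ)).add_const (g 0 1 : ℂ)
  have h2 : HasDerivAt (fun z : ℂ => denom g z) (g 1 0 : ℂ) z := by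
    simpa [denom] using ((hasDerivAt_id (z : ℂ)).const_mul (g 1 0 : ℂ)).add_const (g 1 1 : ℂ)
  convert! h1.div h2 (denom_ne_zero g z) using 1
  congr 1
  rw [Matrix.GeneralLinearGroup.val_det_apply, Matrix.det_fin_two]
  simp only [num, denom]
  push_cast
  ring

/-- The primitive of `f ∣[2] g` obtained from a primitive of `f`. -/
def slashPrimitive (g : GL (Fin 2) ℝ) (F : ℂ → ℂ) (z : ℂ) : ℂ :=
  if 0 < g.det.val then F (num g z / denom g z) else -conj (F (conj (num g z / denom g z)))

/-- The map `u ↦ -ū` preserves imaginary parts. For this reason `Im F`, unlike `F`, behaves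
uniformly under both signs of the determinant. -/
lemma slashPrimitive_im (g : GL (Fin 2) ℝ) (F : ℂ → ℂ) (z : ℍ) :
    (slashPrimitive g F z).im = (F ↑(g • z)).im := by
  rw [slashPrimitive, coe_smul, σ]
  split_ifs <;> simp

lemma eq_slashPrimitive (g : GL (Fin 2) ℝ) (F : ℂ → ℂ) (z : ℍ) :
    F ↑(g • z) = if 0 < g.det.val then slashPrimitive g F z else -conj (slashPrimitive g F z) := by
  rw [slashPrimitive, coe_smul, σ]
  split_ifs <;> simp

/-- The chain rule produces `det/denom²`, the weight two action `|det|/denom²`. For negative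
determinant the sign is absorbed by the minus in `slashPrimitive`. -/
lemma IsPrimitive.slash {F : ℂ → ℂ} {f : ℍ → ℂ} (h : IsPrimitive F f) (g : GL (Fin 2) ℝ) :
    IsPrimitive (slashPrimitive g F) (f ∣[(2 : ℤ)] g) := by
  intro z
  have hd := hasDerivAt_num_div_denom g z
  have hg := h (g • z)
  rw [coe_smul] at hg
  have e : (2 : ℤ) - 1 = 1 := rfl
  by_cases hdet : 0 < g.det.val
  · have hs : slashPrimitive g F = fun z => F (num g z / denom g z) := by
      ext; exact if_pos hdet
    rw [hs, slash_apply]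
    simp only [σ, if_pos hdet, ContinuousAlgEquiv.refl_apply] at hg ⊢
    convert! hg.comp (z : ℂ) hd using 1
    rw [abs_of_pos hdet, e, zpow_one, zpow_neg, zpow_ofNat]
    field_simp
  · have hs : slashPrimitive g F = fun z => -(conj (F (conj (num g z / denom g z)))) := by
      ext; exact if_neg hdet
    rw [hs, slash_apply]
    simp only [σ, if_neg hdet, Complex.conjCAE_apply] at hg ⊢
    have h1 := HasDerivAt.conj_conj hg
    rw [Complex.conj_conj] at h1
    convert! (h1.comp (z : ℂ) hd).neg using 1
    rw [abs_of_nonpos (not_lt.mp hdet), e, zpow_one, zpow_neg, zpow_ofNat]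
    push_cast
    field_simp

/-- If `f ∣[2] g = f`, then `Im F` changes by a constant under `g`. -/
lemma IsPrimitive.im_smul_sub_im {F : ℂ → ℂ} {f : ℍ → ℂ} (h : IsPrimitive F f)
    {g : GL (Fin 2) ℝ} (hg : f ∣[(2 : ℤ)] g = f) (z w : ℍ) :
    (F ↑(g • z)).im - (F z).im = (F ↑(g • w)).im - (F w).im := by
  have h1 : IsPrimitive (slashPrimitive g F) f := by simpa [hg] using h.slash g
  have := congrArg Complex.im (h1.sub_eq_sub_of_same h z w)
  simp only [Complex.sub_im, slashPrimitive_im] at this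
  linarith


/-! ### Exponential decay and limits of primitives at cusps -/

/-- `f` decays exponentially at `i∞`. -/
def DecaysAtImInfty (f : ℍ → ℂ) : Prop :=
  ∃ c > 0, f =O[atImInfty] fun z => Real.exp (-c * z.im)

lemma DecaysAtImInfty.exists_bound {f : ℍ → ℂ} (hf : DecaysAtImInfty f) :
    ∃ c > 0, ∃ C ≥ 0, ∃ A > 0, ∀ z : ℍ, A ≤ z.im → ‖f z‖ ≤ C * Real.exp (-c * z.im) := by
  obtain ⟨c, hc, h⟩ := hf
  obtain ⟨C, hC, h⟩ := h.exists_nonneg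
  obtain ⟨A, hA⟩ := (atImInfty_mem _).mp h.bound
  refine ⟨c, hc, C, hC, max A 1, by positivity, fun z hz => ?_⟩
  simpa using hA z ((le_max_left _ _).trans hz)

/-- A primitive of an exponentially decaying function has a limit at `i∞`. -/
lemma IsPrimitive.exists_tendsto_atImInfty {F : ℂ → ℂ} {f : ℍ → ℂ} (hF : IsPrimitive F f)
    (hf : DecaysAtImInfty f) : ∃ Φ, Tendsto (fun z : ℍ => F z) atImInfty (𝓝 Φ) := by
  obtain ⟨c, hc, C, hC, A, hA, hb⟩ := hf.exists_bound
  have vert : ∀ x y₀ y : ℝ, A ≤ y₀ → y₀ ≤ y →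
      ‖F (x + y * Complex.I) - F (x + y₀ * Complex.I)‖ ≤ C / c * Real.exp (-c * y₀) := by
    intro x y₀ y h0 h1
    have him : ∀ u : ℝ, ((x : ℂ) + u * Complex.I).im = u := by simp
    have hd : ∀ u ∈ Set.Icc y₀ y, HasDerivAt
        (fun u : ℝ => F (x + u * Complex.I) - F (x + y₀ * Complex.I))
        (f (ofComplex (x + u * Complex.I)) * Complex.I) u := by
      intro u hu
      have hp : HasDerivAt (fun u : ℝ => (x : ℂ) + u * Complex.I) Complex.I u := by
        simpa using ((Complex.ofRealCLM.hasDerivAt (x := u)).mul_const Complex.I).const_add (x : ℂ)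
      exact (hF.hasDerivAt_comp hp (by rw [him]; linarith [hu.1])).sub_const _
    have := image_norm_le_of_norm_deriv_right_le_deriv_boundary
      (B := fun u => C / c * (Real.exp (-c * y₀) - Real.exp (-c * u)))
      (B' := fun u => C * Real.exp (-c * u))
      (fun u hu => (hd u hu).continuousAt.continuousWithinAt)
      (fun u hu => (hd u ⟨hu.1, hu.2.le⟩).hasDerivWithinAt) (by simp)
      (fun u => by
        have : HasDerivAt (fun u => Real.exp (-c * u)) (Real.exp (-c * u) * (-c)) u := by
          simpa using ((hasDerivAt_id u).const_mul (-c)).exp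
        convert! (this.const_sub (Real.exp (-c * y₀))).const_mul (C / c) using 1
        field_simp)
      (fun u hu => by
        have hu0 : 0 < ((x : ℂ) + u * Complex.I).im := by rw [him]; linarith [hu.1]
        rw [norm_mul, Complex.norm_I, mul_one, ofComplex_apply_of_im_pos hu0]
        convert! hb ⟨_, hu0⟩ (by
          change A ≤ ((x : ℂ) + u * Complex.I).im
          rw [him]; linarith [hu.1]) using 4
        exact (him u).symm)
      (Set.right_mem_Icc.mpr h1)
    refine this.trans (mul_le_mul_of_nonneg_left ?_ (by positivity))
    linarith [Real.exp_pos (-c * y)]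
  have horiz : ∀ x x' y : ℝ, A ≤ y →
      ‖F (x + y * Complex.I) - F (x' + y * Complex.I)‖ ≤ C * Real.exp (-c * y) * |x - x'| := by
    intro x x' y hy
    have hpos : ∀ z ∈ {z : ℂ | y ≤ z.im}, 0 < z.im := fun z (hz : y ≤ z.im) => by linarith
    have hd : ∀ z ∈ {z : ℂ | y ≤ z.im},
        HasDerivWithinAt F (f (ofComplex z)) {z : ℂ | y ≤ z.im} z := by
      intro z hz
      rw [ofComplex_apply_of_im_pos (hpos z hz)]
      exact (hF ⟨z, hpos z hz⟩).hasDerivWithinAt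
    have := (convex_halfSpace_im_ge y).norm_image_sub_le_of_norm_hasDerivWithin_le
      (C := C * Real.exp (-c * y)) hd (fun z hz => by
        rw [ofComplex_apply_of_im_pos (hpos z hz)]
        have hz' : y ≤ z.im := hz
        refine (hb ⟨z, hpos z hz⟩ (hy.trans hz')).trans (mul_le_mul_of_nonneg_left ?_ hC)
        exact Real.exp_le_exp.mpr (by change -c * z.im ≤ _; nlinarith))
      (x := x' + y * Complex.I) (y := x + y * Complex.I) (by simp) (by simp)
    refine this.trans_eq ?_
    congr 1
    rw [show ((x : ℂ) + y * Complex.I) - (x' + y * Complex.I) = ((x - x' : ℝ) : ℂ) by push_cast; ring,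
      Complex.norm_real, Real.norm_eq_abs]
  have hexp : Tendsto (fun y : ℝ => Real.exp (-c * y)) atTop (𝓝 0) := by
    refine Real.tendsto_exp_atBot.comp ?_
    exact tendsto_id.const_mul_atTop_of_neg (neg_neg_of_pos hc)
  -- Climb from both points to a common height `y` and cross there. The cost of crossing tends to
  -- zero as `y` grows, so the bound does not depend on the horizontal distance.
  have key : ∀ Y, A ≤ Y → ∀ z w : ℍ, Y ≤ z.im → Y ≤ w.im →
      ‖F z - F w‖ ≤ 2 * (C / c) * Real.exp (-c * Y) := by
    intro Y hY z w hz hw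
    have hcoe : ∀ z : ℍ, (z : ℂ) = (z.re : ℂ) + z.im * Complex.I := fun z => by
      simpa using (Complex.re_add_im (z : ℂ)).symm
    have hlim : Tendsto (fun y : ℝ => 2 * (C / c) * Real.exp (-c * Y) +
        C * Real.exp (-c * y) * |z.re - w.re|) atTop (𝓝 (2 * (C / c) * Real.exp (-c * Y))) := by
      simpa using ((hexp.const_mul C).mul_const |z.re - w.re|).const_add
        (2 * (C / c) * Real.exp (-c * Y))
    refine ge_of_tendsto hlim ?_
    filter_upwards [eventually_ge_atTop (max z.im w.im)] with y hy
    have hzy := (le_max_left _ _).trans hy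
    have hwy := (le_max_right _ _).trans hy
    have h1 := vert z.re z.im y (hY.trans hz) hzy
    have h2 := vert w.re w.im y (hY.trans hw) hwy
    have h3 := horiz z.re w.re y ((hY.trans hz).trans hzy)
    rw [← hcoe] at h1 h2
    have hmono : ∀ u, Y ≤ u → C / c * Real.exp (-c * u) ≤ C / c * Real.exp (-c * Y) := fun u hu =>
      mul_le_mul_of_nonneg_left (Real.exp_le_exp.mpr (by nlinarith)) (by positivity)
    have e : F z - F w = -(F (z.re + y * Complex.I) - F z) +
        (F (z.re + y * Complex.I) - F (w.re + y * Complex.I)) +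
        (F (w.re + y * Complex.I) - F w) := by ring
    rw [e]
    refine (norm_add_le _ _).trans ?_
    have := norm_add_le (-(F (z.re + y * Complex.I) - F z))
      (F (z.re + y * Complex.I) - F (w.re + y * Complex.I))
    rw [norm_neg] at this
    linarith [hmono _ hz, hmono _ hw]
  refine cauchy_map_iff_exists_tendsto.mp (Metric.cauchy_iff.mpr ⟨inferInstance, fun ε hε => ?_⟩)
  have hlim : Tendsto (fun y : ℝ => 2 * (C / c) * Real.exp (-c * y)) atTop (𝓝 0) := by
    simpa using hexp.const_mul (2 * (C / c))
  obtain ⟨Y, hY, hYA⟩ := ((hlim.eventually_lt_const hε).and (eventually_ge_atTop A)).exists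
  refine ⟨(fun z : ℍ => F z) '' {z | Y ≤ z.im}, image_mem_map ((atImInfty_mem _).mpr
    ⟨Y, fun _ h => h⟩), ?_⟩
  rintro _ ⟨z, hz, rfl⟩ _ ⟨w, hw, rfl⟩
  rw [dist_eq_norm]
  exact (key Y hYA z w hz hw).trans_lt hY

/-- The factor `im ^ 2` is the price of undoing the slash action when a finite cusp is approached.
-/
lemma DecaysAtImInfty.tendsto_im_sq_mul {f : ℍ → ℂ} (hf : DecaysAtImInfty f) :
    Tendsto (fun z : ℍ => ‖f z‖ * z.im ^ 2) atImInfty (𝓝 0) := by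
  obtain ⟨c, hc, C, hC, A, hA, hb⟩ := hf.exists_bound
  have h : Tendsto (fun z : ℍ => C * (z.im ^ (2 : ℝ) * Real.exp (-c * z.im))) atImInfty (𝓝 0) := by
    rw [← mul_zero C]
    exact ((tendsto_rpow_mul_exp_neg_mul_atTop_nhds_zero 2 c hc).comp
      (tendsto_comap : Tendsto UpperHalfPlane.im atImInfty atTop)).const_mul C
  refine squeeze_zero' (.of_forall fun z => by positivity) ?_ h
  refine (atImInfty_mem _).mpr ⟨A, fun z hz => ?_⟩
  have := mul_le_mul_of_nonneg_right (hb z hz) (sq_nonneg z.im)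
  simp only [Set.mem_ofPred_eq, Real.rpow_ofNat]
  linarith

/-- Behaviour of the imaginary part and of the distance to a finite cusp `σ∞ = q`. -/
lemma im_div_normSq_sub {σ : GL (Fin 2) ℝ} {q : ℝ}
    (hσ : σ • (OnePoint.infty : OnePoint ℝ) = (q : OnePoint ℝ)) :
    ∃ κ > 0, ∀ w : ℍ, (σ • w).im / Complex.normSq (↑(σ • w) - q) = κ * w.im := by
  rw [OnePoint.smul_infty_eq_ite] at hσ
  split_ifs at hσ with hc
  · exact absurd hσ (OnePoint.infty_ne_coe q)
  have hq : q = σ 0 0 / σ 1 0 := (OnePoint.coe_injective hσ).symm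
  have hdet := σ.det_ne_zero
  refine ⟨(σ 1 0) ^ 2 / |σ.det.val|, div_pos (by positivity) (abs_pos.mpr hdet), fun w => ?_⟩
  have hd := denom_ne_zero σ w
  have hcc : (σ 1 0 : ℂ) ≠ 0 := by exact_mod_cast hc
  have hsub : num σ w / denom σ w - q = -(σ.det.val : ℂ) / (σ 1 0 * denom σ w) := by
    rw [hq, Matrix.GeneralLinearGroup.val_det_apply, Matrix.det_fin_two]
    push_cast
    field_simp
    simp only [num, denom]
    ring
  have hns : Complex.normSq (↑(σ • w) - q) =
      σ.det.val ^ 2 / ((σ 1 0) ^ 2 * Complex.normSq (denom σ w)) := by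
    have : (↑(σ • w) : ℂ) - q = UpperHalfPlane.σ σ (num σ w / denom σ w - q) := by
      rw [map_sub, σ_ofReal, coe_smul]
    rw [this, Complex.normSq_eq_norm_sq, norm_σ, ← Complex.normSq_eq_norm_sq, hsub]
    simp only [map_div₀, map_mul, Complex.normSq_neg, Complex.normSq_ofReal]
    ring
  have hn := normSq_denom_ne_zero σ w.im_ne_zero
  rw [hns, im_smul_eq_div_normSq]
  have habs : |σ.det.val| ≠ 0 := abs_ne_zero.mpr hdet
  rw [← sq_abs σ.det.val]
  field_simp

/-- Approach to a finite cusp `q = σ∞` along a path on which `Im z` and `|z - q|` are comparable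
up to the stated bounds: `f` tends to zero and a primitive of `f` to its value at the cusp. -/
lemma tendsto_of_tendsto_cusp {F : ℂ → ℂ} {f : ℍ → ℂ} {σ : GL (Fin 2) ℝ} {q : ℝ} {Φ : ℂ}
    (hσ : σ • (OnePoint.infty : OnePoint ℝ) = (q : OnePoint ℝ))
    (hf : DecaysAtImInfty (f ∣[(2 : ℤ)] σ))
    (hΦ : Tendsto (fun z : ℍ => F ↑(σ • z)) atImInfty (𝓝 Φ))
    {l : Filter ℝ} {p : ℝ → ℍ} {δ : ℝ} (hδ : 0 < δ)
    (h1 : Tendsto (fun t => (p t).im / Complex.normSq (p t - q)) l atTop)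
    (h2 : ∀ᶠ t in l, δ ≤ (p t).im ^ 2 / Complex.normSq (p t - q)) :
    Tendsto (fun t => f (p t)) l (𝓝 0) ∧ Tendsto (fun t => F (p t)) l (𝓝 Φ) := by
  obtain ⟨κ, hκ, hk⟩ := im_div_normSq_sub hσ
  have hw : ∀ t, κ * (σ⁻¹ • p t).im = (p t).im / Complex.normSq (p t - q) := fun t => by
    rw [← hk, smul_inv_smul]
  have hlim : Tendsto (fun t => σ⁻¹ • p t) l atImInfty := by
    refine tendsto_comap_iff.mpr ?_
    simp_rw [← hw] at h1
    exact (tendsto_const_mul_atTop_of_pos hκ).mp h1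
  refine ⟨?_, by simpa [Function.comp_def] using hΦ.comp hlim⟩
  rw [tendsto_zero_iff_norm_tendsto_zero]
  have h0 : Tendsto (fun t => κ / δ * (‖(f ∣[(2 : ℤ)] σ) (σ⁻¹ • p t)‖ * (σ⁻¹ • p t).im ^ 2)) l
      (𝓝 0) := by
    simpa using (hf.tendsto_im_sq_mul.comp hlim).const_mul (κ / δ)
  refine squeeze_zero' (.of_forall fun t => norm_nonneg _) ?_ h0
  filter_upwards [h2] with t ht
  set w := σ⁻¹ • p t with hwdef
  have hp : p t = σ • w := by rw [hwdef, smul_inv_smul]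
  have hd : Complex.normSq (denom σ w) ≠ 0 := normSq_denom_ne_zero σ w.im_ne_zero
  have habs : |σ.det.val| ≠ 0 := abs_ne_zero.mpr σ.det_ne_zero
  -- The weight two action scales norms by the ratio of heights; `h2` then bounds `1 / im (p t)` by
  -- `κ im w / δ`.
  have hns : ‖(f ∣[(2 : ℤ)] σ) w‖ = ‖f (p t)‖ * ((p t).im / w.im) := by
    have hwim := w.im_ne_zero
    rw [slash_apply, norm_mul, norm_mul, norm_σ, ← hp, hp, im_smul_eq_div_normSq,
      show (2 : ℤ) - 1 = 1 from rfl, zpow_one, Complex.norm_real, Real.norm_eq_abs, abs_abs,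
      norm_zpow, zpow_neg, zpow_ofNat, ← Complex.normSq_eq_norm_sq]
    field_simp
  have hδ' : δ ≤ (p t).im * (κ * w.im) := by
    rw [hw t]
    calc δ ≤ _ := ht
      _ = _ := by ring
  rw [hns]
  have hwpos := w.im_pos
  have e : κ / δ * (‖f (p t)‖ * ((p t).im / w.im) * w.im ^ 2) =
      ‖f (p t)‖ * ((p t).im * (κ * w.im) / δ) := by
    field_simp
  rw [e]
  exact le_mul_of_one_le_right (norm_nonneg _) ((one_le_div hδ).mpr hδ')

/-! ### Arcs ending at cusps -/

lemma verticalIntegral_Ioi_zero {F : ℂ → ℂ} {f : ℍ → ℂ} (hF : IsPrimitive F f)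
    (hf : Continuous f) (hd : DecaysAtImInfty f) {x : ℝ} {Φ₀ Φ : ℂ}
    (hf0 : Tendsto (fun t : ℝ => f (ofComplex (x + t * Complex.I))) (𝓝[>] 0) (𝓝 0))
    (hF0 : Tendsto (fun t : ℝ => F (x + t * Complex.I)) (𝓝[>] 0) (𝓝 Φ₀))
    (hΦ : Tendsto (fun t : ℝ => F (x + t * Complex.I)) atTop (𝓝 Φ)) :
    verticalIntegral f x (Set.Ioi 0) = Φ - Φ₀ := by
  have him : ∀ u : ℝ, ((x : ℂ) + u * Complex.I).im = u := by simp
  have hp : ∀ u : ℝ, HasDerivAt (fun u : ℝ => (x : ℂ) + u * Complex.I) Complex.I u := fun u => by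
    simpa using ((Complex.ofRealCLM.hasDerivAt (x := u)).mul_const Complex.I).const_add (x : ℂ)
  set h : ℝ → ℂ := fun t => f (ofComplex (x + t * Complex.I)) * Complex.I with hh
  -- On the real line `ofComplex` has no meaningful value. Putting the limit at `0` makes the
  -- integrand continuous on the closed half line, and exponential decay then gives integrability.
  set h' : ℝ → ℂ := Function.update h 0 0 with hh'
  set H : ℝ → ℂ := Function.update (fun t : ℝ => F (x + t * Complex.I)) 0 Φ₀ with hH
  have hlim0 : Tendsto h (𝓝[>] 0) (𝓝 0) := by simpa using hf0.mul_const Complex.I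
  have hcontAt : ∀ t : ℝ, 0 < t → ContinuousAt h t := fun t ht => by
    refine ContinuousAt.mul ?_ continuousAt_const
    refine ContinuousAt.comp (g := fun z => f (ofComplex z))
      (f := fun t : ℝ => (x : ℂ) + t * Complex.I) ?_ (hp t).continuousAt
    refine (continuousOn_comp_ofComplex hf).continuousAt
      ((isOpen_lt continuous_const Complex.continuous_im).mem_nhds ?_)
    rw [Set.mem_ofPred_eq, him]
    exact ht
  have hcont : ContinuousOn h' (Set.Ici 0) := by
    intro t ht
    rcases eq_or_lt_of_le (Set.mem_Ici.mp ht) with h0 | h0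
    · subst h0
      rw [hh', continuousWithinAt_update_same]
      rwa [show Set.Ici (0 : ℝ) \ {0} = Set.Ioi 0 from Set.Ici_sdiff_left]
    · refine ((hcontAt t h0).congr ?_).continuousWithinAt
      filter_upwards [lt_mem_nhds h0] with s hs
      exact (Function.update_of_ne hs.ne' _ _).symm
  have hae : Set.EqOn h' h (Set.Ioi 0) := fun t ht => Function.update_of_ne (ne_of_gt ht) _ _
  have hint : IntegrableOn h' (Set.Ioi 0) := by
    obtain ⟨c, hc, hO⟩ := hd
    have hv : Tendsto (fun t : ℝ => ofComplex ((x : ℂ) + t * Complex.I)) atTop atImInfty := by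
      refine tendsto_comap_im_ofComplex.comp (tendsto_comap_iff.mpr ?_)
      simpa [Function.comp_def] using! tendsto_id
    have hO' : (fun t => ‖h' t‖) =O[atTop] fun t : ℝ => Real.exp (-c * t) := by
      refine Asymptotics.IsBigO.norm_left ?_
      refine ((hO.comp_tendsto hv).norm_left.congr' ?_ ?_).of_norm_left
      · filter_upwards [eventually_gt_atTop 0] with t ht
        rw [hae ht, hh, norm_mul, Complex.norm_I, mul_one, Function.comp_apply]
      · filter_upwards [eventually_gt_atTop 0] with t ht
        rw [Function.comp_apply, ← coe_im, ofComplex_apply_of_im_pos (by rw [him]; exact ht)]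
        change Real.exp (-c * ((x : ℂ) + t * Complex.I).im) = _
        rw [him]
    have := integrable_of_isBigO_exp_neg hc hcont.norm hO'
    refine (integrable_norm_iff ?_).mp this
    exact (hcont.mono Set.Ioi_subset_Ici_self).aestronglyMeasurable measurableSet_Ioi
  have hderiv : ∀ t ∈ Set.Ioi (0 : ℝ), HasDerivAt H (h t) t := fun t ht => by
    refine (hF.hasDerivAt_comp (hp t) (by rw [him]; exact ht)).congr_of_eventuallyEq ?_
    filter_upwards [lt_mem_nhds ht] with s hs
    exact Function.update_of_ne (ne_of_gt hs) _ _
  have hcontH : ContinuousWithinAt H (Set.Ici 0) 0 := by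
    rw [hH, continuousWithinAt_update_same]
    rwa [show Set.Ici (0 : ℝ) \ {0} = Set.Ioi 0 from Set.Ici_sdiff_left]
  have hHlim : Tendsto H atTop (𝓝 Φ) := by
    refine hΦ.congr' ?_
    filter_upwards [eventually_gt_atTop 0] with t ht
    rw [hH, Function.update_of_ne (ne_of_gt ht)]
  have := integral_Ioi_of_hasDerivAt_of_tendsto hcontH hderiv
    (hint.congr_fun hae measurableSet_Ioi) hHlim
  rwa [show H 0 = Φ₀ from Function.update_self _ _ _] at this

lemma integral_half_circle {F : ℂ → ℂ} {f : ℍ → ℂ} (hF : IsPrimitive F f)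
    (hf : Continuous f) {c r : ℝ} (hr : 0 < r) {Φ₀ Φ : ℂ}
    (hf0 : Tendsto (fun θ : ℝ => f (ofComplex (c + r * Complex.exp (θ * Complex.I)))) (𝓝[>] 0)
      (𝓝 0))
    (hF0 : Tendsto (fun θ : ℝ => F (c + r * Complex.exp (θ * Complex.I))) (𝓝[>] 0) (𝓝 Φ₀))
    (hfpi : Tendsto (fun θ : ℝ => f (ofComplex (c + r * Complex.exp (θ * Complex.I))))
      (𝓝[<] Real.pi) (𝓝 0))
    (hFpi : Tendsto (fun θ : ℝ => F (c + r * Complex.exp (θ * Complex.I))) (𝓝[<] Real.pi) (𝓝 Φ)) :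
    ∫ θ in (0 : ℝ)..Real.pi, f (ofComplex (c + r * Complex.exp (θ * Complex.I))) *
      (r * Complex.I * Complex.exp (θ * Complex.I)) = Φ - Φ₀ := by
  have hpos : ∀ θ ∈ Set.Ioo 0 Real.pi, 0 < ((c : ℂ) + r * Complex.exp (θ * Complex.I)).im := by
    intro θ hθ
    rw [im_circle]
    exact mul_pos hr (Real.sin_pos_of_pos_of_lt_pi hθ.1 hθ.2)
  have hj : Continuous fun θ : ℝ => (r : ℂ) * Complex.I * Complex.exp (θ * Complex.I) := by fun_prop
  refine intervalIntegral.integral_eq_sub_of_hasDerivAt_of_tendsto Real.pi_pos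
    (fun θ hθ => hF.hasDerivAt_comp (hasDerivAt_circle c r θ) (hpos θ hθ)) ?_ hF0 hFpi
  have hcont : ContinuousOn (fun θ : ℝ => f (ofComplex (c + r * Complex.exp (θ * Complex.I))) *
      (r * Complex.I * Complex.exp (θ * Complex.I))) (Set.Ioo 0 Real.pi) :=
    ((continuousOn_comp_ofComplex hf).comp (by fun_prop) hpos).mul hj.continuousOn
  have hext := continuousOn_Icc_extendFrom_Ioo hcont
    (hf0.mul ((hj.tendsto 0).mono_left nhdsWithin_le_nhds))
    (hfpi.mul ((hj.tendsto Real.pi).mono_left nhdsWithin_le_nhds))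
  rw [← Set.uIcc_of_le Real.pi_pos.le] at hext
  refine hext.intervalIntegrable.congr_uIoo fun θ hθ => ?_
  rw [Set.uIoo_of_le Real.pi_pos.le] at hθ
  exact extendFrom_extends hcont θ hθ

/-- Approach to the end `c + ε r`, `ε = ± 1`, of a half circle. -/
lemma tendsto_circle_end {F : ℂ → ℂ} {f : ℍ → ℂ} {σ : GL (Fin 2) ℝ} {c r ε : ℝ} {Φ : ℂ}
    (hr : 0 < r) (hε : ε ^ 2 = 1)
    (hσ : σ • (OnePoint.infty : OnePoint ℝ) = ((c + ε * r : ℝ) : OnePoint ℝ))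
    (hf : DecaysAtImInfty (f ∣[(2 : ℤ)] σ))
    (hΦ : Tendsto (fun z : ℍ => F ↑(σ • z)) atImInfty (𝓝 Φ))
    {l : Filter ℝ} (hcos : Tendsto Real.cos l (𝓝 ε)) (hsin : Tendsto Real.sin l (𝓝[>] 0)) :
    Tendsto (fun θ : ℝ => f (ofComplex (c + r * Complex.exp (θ * Complex.I)))) l (𝓝 0) ∧
      Tendsto (fun θ : ℝ => F (c + r * Complex.exp (θ * Complex.I))) l (𝓝 Φ) := by
  have hpos : ∀ᶠ θ in l, 0 < Real.sin θ := hsin.eventually self_mem_nhdsWithin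
  have hcoe : ∀ᶠ θ : ℝ in l, (ofComplex (c + r * Complex.exp (θ * Complex.I)) : ℂ) =
      c + r * Complex.exp (θ * Complex.I) := by
    filter_upwards [hpos] with θ hθ
    rw [ofComplex_apply_of_im_pos (by rw [im_circle]; exact mul_pos hr hθ)]
  have hns : ∀ θ : ℝ, Complex.normSq (c + r * Complex.exp (θ * Complex.I) - (c + ε * r : ℝ)) =
      2 * r ^ 2 * (1 - ε * Real.cos θ) := by
    intro θ
    rw [Complex.normSq_apply, Complex.sub_re, Complex.sub_im, re_circle, im_circle,
      Complex.ofReal_re, Complex.ofReal_im]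
    linear_combination r ^ 2 * hε + r ^ 2 * Real.sin_sq_add_cos_sq θ
  have hsq : ∀ θ : ℝ, Real.sin θ ^ 2 = (1 - ε * Real.cos θ) * (1 + ε * Real.cos θ) := by
    intro θ
    linear_combination Real.sin_sq_add_cos_sq θ + Real.cos θ ^ 2 * hε
  have hlim2 : Tendsto (fun θ => 1 + ε * Real.cos θ) l (𝓝 2) := by
    convert! (hcos.const_mul ε).const_add 1 using 2
    rw [← sq, hε]; norm_num
  have hne : ∀ᶠ θ in l, 0 < 1 - ε * Real.cos θ := by
    filter_upwards [hpos, hlim2.eventually (lt_mem_nhds (show (0 : ℝ) < 2 by norm_num))] with θ h1 h2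
    have := hsq θ
    by_contra h3
    nlinarith [pow_pos h1 2]
  -- The two quotients to be controlled are `(1 + ε cos θ)/(2 r sin θ)` and `(1 + ε cos θ)/2`. The
  -- second tends to `1`, so `1/2` is a lower bound near the end.
  have key := tendsto_of_tendsto_cusp (F := F) hσ hf hΦ (l := l)
    (p := fun θ : ℝ => ofComplex (c + r * Complex.exp (θ * Complex.I))) (δ := 1 / 2) (by norm_num)
    ?_ ?_
  · refine ⟨key.1, key.2.congr' ?_⟩
    filter_upwards [hcoe] with θ hθ
    rw [hθ]
  · have h1 : Tendsto (fun θ => (1 + ε * Real.cos θ) * (2 * r)⁻¹ * (Real.sin θ)⁻¹) l atTop := by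
      refine Tendsto.pos_mul_atTop (C := 2 * (2 * r)⁻¹) (by positivity) (hlim2.mul_const _) ?_
      exact tendsto_inv_nhdsGT_zero.comp hsin
    refine h1.congr' ?_
    filter_upwards [hcoe, hpos, hne] with θ hθ h1 h2
    rw [← coe_im, hθ, hns, im_circle]
    have := hsq θ
    field_simp
    linear_combination -this
  · filter_upwards [hcoe, hpos, hne, hlim2.eventually (lt_mem_nhds (show (1 : ℝ) < 2 by norm_num))]
      with θ hθ h1 h2 h3
    rw [← coe_im, hθ, hns, im_circle, mul_pow, hsq]
    rw [le_div_iff₀ (by positivity)]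
    have : 0 < r ^ 2 * (1 - ε * Real.cos θ) := by positivity
    nlinarith

/-- Approach to a finite cusp along a vertical line. -/
lemma tendsto_vertical_end {F : ℂ → ℂ} {f : ℍ → ℂ} {σ : GL (Fin 2) ℝ} {q : ℝ} {Φ : ℂ}
    (hσ : σ • (OnePoint.infty : OnePoint ℝ) = (q : OnePoint ℝ))
    (hf : DecaysAtImInfty (f ∣[(2 : ℤ)] σ))
    (hΦ : Tendsto (fun z : ℍ => F ↑(σ • z)) atImInfty (𝓝 Φ)) :
    Tendsto (fun t : ℝ => f (ofComplex (q + t * Complex.I))) (𝓝[>] 0) (𝓝 0) ∧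
      Tendsto (fun t : ℝ => F (q + t * Complex.I)) (𝓝[>] 0) (𝓝 Φ) := by
  have hcoe : ∀ᶠ t : ℝ in 𝓝[>] 0, (ofComplex (q + t * Complex.I) : ℂ) = q + t * Complex.I := by
    filter_upwards [self_mem_nhdsWithin] with t ht
    rw [ofComplex_apply_of_im_pos (by simpa using ht)]
  have hns : ∀ t : ℝ, Complex.normSq (q + t * Complex.I - q) = t ^ 2 := by
    intro t
    rw [add_sub_cancel_left]
    simp [sq]
  have key := tendsto_of_tendsto_cusp (F := F) hσ hf hΦ (l := 𝓝[>] 0)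
    (p := fun t : ℝ => ofComplex (q + t * Complex.I)) (δ := 1) one_pos ?_ ?_
  · refine ⟨key.1, key.2.congr' ?_⟩
    filter_upwards [hcoe] with t ht
    rw [ht]
  · refine tendsto_inv_nhdsGT_zero.congr' ?_
    filter_upwards [hcoe, self_mem_nhdsWithin] with t ht h0
    have h0' : t ≠ 0 := ne_of_gt h0
    rw [← coe_im, ht, hns]
    simp
    field_simp
  · filter_upwards [hcoe, self_mem_nhdsWithin] with t ht h0
    have h0' : t ≠ 0 := ne_of_gt h0
    rw [← coe_im, ht, hns]
    simp [h0']

/-- The integral along a half circle joining two finite cusps. -/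
lemma arcIntegral_real_cusps {F : ℂ → ℂ} {f : ℍ → ℂ} (hF : IsPrimitive F f) (hfc : Continuous f)
    {σ σ' : GL (Fin 2) ℝ} {q q' : ℝ} (hne : q ≠ q') {Φ Φ' : ℂ}
    (hσ : σ • (OnePoint.infty : OnePoint ℝ) = (q : OnePoint ℝ))
    (hσ' : σ' • (OnePoint.infty : OnePoint ℝ) = (q' : OnePoint ℝ))
    (hf : DecaysAtImInfty (f ∣[(2 : ℤ)] σ)) (hf' : DecaysAtImInfty (f ∣[(2 : ℤ)] σ'))
    (hΦ : Tendsto (fun z : ℍ => F ↑(σ • z)) atImInfty (𝓝 Φ))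
    (hΦ' : Tendsto (fun z : ℍ => F ↑(σ' • z)) atImInfty (𝓝 Φ')) :
    arcIntegral f ((q : ℂ) : OnePoint ℂ) ((q' : ℂ) : OnePoint ℂ) = Φ' - Φ := by
  have hcos0 : Tendsto Real.cos (𝓝[>] 0) (𝓝 1) := by
    simpa using (Real.continuous_cos.tendsto 0).mono_left nhdsWithin_le_nhds
  have hcospi : Tendsto Real.cos (𝓝[<] Real.pi) (𝓝 (-1)) := by
    simpa using (Real.continuous_cos.tendsto Real.pi).mono_left nhdsWithin_le_nhds
  have hsin0 : Tendsto Real.sin (𝓝[>] 0) (𝓝[>] 0) := by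
    refine tendsto_nhdsWithin_iff.mpr ⟨by
      simpa using (Real.continuous_sin.tendsto 0).mono_left nhdsWithin_le_nhds, ?_⟩
    filter_upwards [Ioo_mem_nhdsGT Real.pi_pos] with θ hθ
    exact Real.sin_pos_of_pos_of_lt_pi hθ.1 hθ.2
  have hsinpi : Tendsto Real.sin (𝓝[<] Real.pi) (𝓝[>] 0) := by
    refine tendsto_nhdsWithin_iff.mpr ⟨by
      simpa using (Real.continuous_sin.tendsto Real.pi).mono_left nhdsWithin_le_nhds, ?_⟩
    filter_upwards [Ioo_mem_nhdsLT Real.pi_pos] with θ hθ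
    exact Real.sin_pos_of_pos_of_lt_pi hθ.1 hθ.2
  change (if ((q : ℂ)).re = ((q' : ℂ)).re then _ else _) = _
  rw [if_neg (by simpa using hne)]
  have hsub : q' - q ≠ 0 := sub_ne_zero.mpr hne.symm
  have hc : (Complex.normSq (q' : ℂ) - Complex.normSq (q : ℂ)) / (2 * ((q' : ℂ).re - (q : ℂ).re)) =
      (q + q') / 2 := by
    simp only [Complex.normSq_ofReal, Complex.ofReal_re]
    field_simp
    ring
  simp only [hc]
  have e1 : (q : ℂ) - ((q + q') / 2 : ℝ) = ((q - q') / 2 : ℝ) := by push_cast; ring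
  have e2 : (q' : ℂ) - ((q + q') / 2 : ℝ) = ((q' - q) / 2 : ℝ) := by push_cast; ring
  rw [e1, e2, Complex.norm_real, Real.norm_eq_abs]
  -- Seen from the centre, the left end has argument `π` and the right end `0`; the order of `q` and
  -- `q'` decides the direction of travel.
  rcases lt_or_gt_of_ne hne with h | h
  · have hr : 0 < (q' - q) / 2 := by linarith
    rw [Complex.arg_ofReal_of_neg (by linarith), Complex.arg_ofReal_of_nonneg hr.le,
      show |(q - q') / 2| = (q' - q) / 2 by rw [abs_of_neg (by linarith)]; ring,
      intervalIntegral.integral_symm]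
    have h0 := tendsto_circle_end (F := F) (f := f) (σ := σ') (c := (q + q') / 2) (ε := 1) hr
      (by norm_num) (by rw [hσ']; congr 1; ring) hf' hΦ' hcos0 hsin0
    have hpi := tendsto_circle_end (F := F) (f := f) (σ := σ) (c := (q + q') / 2) (ε := -1) hr
      (by norm_num) (by rw [hσ]; congr 1; ring) hf hΦ hcospi hsinpi
    rw [integral_half_circle hF hfc hr h0.1 h0.2 hpi.1 hpi.2]
    ring
  · have hr : 0 < (q - q') / 2 := by linarith
    rw [Complex.arg_ofReal_of_neg (x := (q' - q) / 2) (by linarith),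
      Complex.arg_ofReal_of_nonneg hr.le, abs_of_pos hr]
    have h0 := tendsto_circle_end (F := F) (f := f) (σ := σ) (c := (q + q') / 2) (ε := 1) hr
      (by norm_num) (by rw [hσ]; congr 1; ring) hf hΦ hcos0 hsin0
    have hpi := tendsto_circle_end (F := F) (f := f) (σ := σ') (c := (q + q') / 2) (ε := -1) hr
      (by norm_num) (by rw [hσ']; congr 1; ring) hf' hΦ' hcospi hsinpi
    rw [integral_half_circle hF hfc hr h0.1 h0.2 hpi.1 hpi.2]

/-- The integral along a vertical line from a finite cusp to `∞`. -/
lemma verticalIntegral_cusp {F : ℂ → ℂ} {f : ℍ → ℂ} (hF : IsPrimitive F f) (hfc : Continuous f)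
    {σ σ' : GL (Fin 2) ℝ} {q : ℝ} {Φ Φ' : ℂ}
    (hσ : σ • (OnePoint.infty : OnePoint ℝ) = (q : OnePoint ℝ))
    (hσ' : σ' • (OnePoint.infty : OnePoint ℝ) = OnePoint.infty)
    (hf : DecaysAtImInfty (f ∣[(2 : ℤ)] σ)) (hf' : DecaysAtImInfty f)
    (hΦ : Tendsto (fun z : ℍ => F ↑(σ • z)) atImInfty (𝓝 Φ))
    (hΦ' : Tendsto (fun z : ℍ => F ↑(σ' • z)) atImInfty (𝓝 Φ')) :
    verticalIntegral f q (Set.Ioi 0) = Φ' - Φ := by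
  have h0 := tendsto_vertical_end (F := F) hσ hf hΦ
  refine verticalIntegral_Ioi_zero hF hfc hf' h0.1 h0.2 ?_
  -- Since `σ'` fixes `∞`, its inverse is upper triangular and preserves `atImInfty`, so `F` itself
  -- tends to `Φ'` there.
  have hinv : (σ'⁻¹) 1 0 = 0 := by
    rw [← OnePoint.smul_infty_eq_self_iff, inv_smul_eq_iff, hσ']
  have hv : Tendsto (fun t : ℝ => ofComplex ((q : ℂ) + t * Complex.I)) atTop atImInfty := by
    refine tendsto_comap_im_ofComplex.comp (tendsto_comap_iff.mpr ?_)
    simpa [Function.comp_def] using! tendsto_id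
  have h1 := hΦ'.comp ((tendsto_smul_atImInfty hinv).comp hv)
  simp only [Function.comp_def, smul_inv_smul] at h1
  refine h1.congr' ?_
  filter_upwards [eventually_gt_atTop 0] with t ht
  rw [ofComplex_apply_of_im_pos (by simpa using ht)]


/-! ### Cusp forms for a finite index subgroup -/

/-- The image in `GL(2,ℝ)` of an integral matrix. -/
abbrev toReal (σ : GL (Fin 2) ℤ) : GL (Fin 2) ℝ :=
  Matrix.GeneralLinearGroup.map (Int.castRingHom ℝ) σ

variable {G : Subgroup PGL(2, ℤ)}

lemma toReal_mem_realGroup {γ : GL (Fin 2) ℤ} (hγ : Matrix.ProjGenLinGroup.mk γ ∈ G) :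
    toReal γ ∈ realGroup G :=
  Subgroup.mem_map_of_mem _ (Subgroup.mem_comap.mpr hγ)

lemma FirstKind.continuous (f : FirstKind G) : Continuous (f : ℍ → ℂ) :=
  (CuspFormClass.holo f).continuous

lemma upperRightHom_natCast (n : ℕ) :
    Matrix.GeneralLinearGroup.upperRightHom (n : ℝ) = toReal (cfTranslate 1 ^ n) := by
  have h1 : Matrix.GeneralLinearGroup.upperRightHom (1 : ℝ) = toReal (cfTranslate 1) := by
    ext i j
    fin_cases i <;> fin_cases j <;> simp [cfTranslate, Matrix.GeneralLinearGroup.upperRightHom]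
  rw [toReal, map_pow, ← toReal, ← h1, ← AddChar.map_nsmul_eq_pow]
  simp

/-- By finite index a power `n > 0` of the parabolic element `σ (1 1; 0 1) σ⁻¹` lies in `G`. So `f ∣
σ` is a cusp form of period `n`, which decays at rate `2π/n`. -/
lemma FirstKind.decaysAtImInfty [G.FiniteIndex] (f : FirstKind G) (σ : GL (Fin 2) ℤ) :
    DecaysAtImInfty ((f : ℍ → ℂ) ∣[(2 : ℤ)] toReal σ) := by
  obtain ⟨n, hn, -, hmem⟩ := Subgroup.exists_pow_mem_of_index_ne_zero
    (Subgroup.FiniteIndex.index_ne_zero (H := G))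
    (Matrix.ProjGenLinGroup.mk (σ * cfTranslate 1 * σ⁻¹))
  have hper : (n : ℝ) ∈ (ConjAct.toConjAct (toReal σ)⁻¹ • realGroup G).strictPeriods := by
    rw [Subgroup.mem_strictPeriods_iff, Subgroup.mem_pointwise_smul_iff_inv_smul_mem,
      ← ConjAct.toConjAct_inv, ConjAct.toConjAct_smul, inv_inv, upperRightHom_natCast,
      ← map_inv, ← map_mul, ← map_mul]
    refine toReal_mem_realGroup ?_
    rwa [← map_pow, conj_pow] at hmem
  have hpos : (0 : ℝ) < n := by exact_mod_cast hn
  refine ⟨2 * Real.pi / n, by positivity, ?_⟩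
  have := CuspFormClass.exp_decay_atImInfty (CuspForm.translate f (toReal σ)) hpos hper
  convert! this using 3
  ring

lemma FirstKind.exists_tendsto [G.FiniteIndex] (f : FirstKind G) {F : ℂ → ℂ}
    (hF : IsPrimitive F f) (σ : GL (Fin 2) ℤ) :
    ∃ Φ, Tendsto (fun z : ℍ => F ↑(toReal σ • z)) atImInfty (𝓝 Φ) := by
  obtain ⟨Φ, hΦ⟩ := (hF.slash (toReal σ)).exists_tendsto_atImInfty (f.decaysAtImInfty σ)
  simp_rw [eq_slashPrimitive]
  split_ifs
  · exact ⟨Φ, hΦ⟩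
  · exact ⟨_, ((Complex.continuous_conj.tendsto Φ).comp hΦ).neg⟩

lemma FirstKind.im_smul_sub_im (f : FirstKind G) {F : ℂ → ℂ} (hF : IsPrimitive F f)
    {γ : GL (Fin 2) ℤ} (hγ : Matrix.ProjGenLinGroup.mk γ ∈ G) (z w : ℍ) :
    (F ↑(toReal γ • z)).im - (F z).im = (F ↑(toReal γ • w)).im - (F w).im :=
  hF.im_smul_sub_im (SlashInvariantFormClass.slash_action_eq f _ (toReal_mem_realGroup hγ)) z w

/-- The cusp `σ∞` of an integral matrix `σ`. -/
def cusp (σ : GL (Fin 2) ℤ) : OnePoint ℚ :=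
  Matrix.GeneralLinearGroup.map (Int.castRingHom ℚ) σ • OnePoint.infty

lemma toReal_smul_infty (σ : GL (Fin 2) ℤ) :
    toReal σ • (OnePoint.infty : OnePoint ℝ) = OnePoint.map (Rat.castHom ℝ) (cusp σ) := by
  rw [cusp, OnePoint.map_smul, OnePoint.map_infty]
  congr 1

/-- The integral along the geodesic joining two cusps. -/
lemma FirstKind.arcIntegral_cusps [G.FiniteIndex] (f : FirstKind G) {F : ℂ → ℂ}
    (hF : IsPrimitive F f) {σ σ' : GL (Fin 2) ℤ} (hne : cusp σ ≠ cusp σ') {Φ Φ' : ℂ}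
    (hΦ : Tendsto (fun z : ℍ => F ↑(toReal σ • z)) atImInfty (𝓝 Φ))
    (hΦ' : Tendsto (fun z : ℍ => F ↑(toReal σ' • z)) atImInfty (𝓝 Φ')) :
    arcIntegral f (HBar.toSphere (.inr (cusp σ))) (HBar.toSphere (.inr (cusp σ'))) = Φ' - Φ := by
  have hσ := toReal_smul_infty σ
  have hσ' := toReal_smul_infty σ'
  have hd : DecaysAtImInfty (f : ℍ → ℂ) := by simpa using f.decaysAtImInfty 1
  generalize cusp σ = c at *
  generalize cusp σ' = c' at *
  have hcast : ∀ q : ℚ, ((q : ℝ) : ℂ) = (q : ℂ) := fun q => by push_cast; rfl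
  have hvert : ∀ q : ℚ, -verticalIntegral f (q : ℂ).re (Set.Ioi (q : ℂ).im) =
      -verticalIntegral f (q : ℝ) (Set.Ioi 0) := fun q => by simp
  induction c using OnePoint.rec with
  | infty =>
    induction c' using OnePoint.rec with
    | infty => exact absurd rfl hne
    | coe q' =>
      have := verticalIntegral_cusp hF f.continuous (q := (q' : ℝ)) hσ' (by simpa using hσ)
        (f.decaysAtImInfty σ') hd hΦ' hΦ
      change -verticalIntegral f (q' : ℂ).re (Set.Ioi (q' : ℂ).im) = _
      rw [hvert, this]
      ring
  | coe q =>
    induction c' using OnePoint.rec with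
    | infty =>
      have := verticalIntegral_cusp hF f.continuous (q := (q : ℝ)) hσ (by simpa using hσ')
        (f.decaysAtImInfty σ) hd hΦ hΦ'
      change verticalIntegral f (q : ℂ).re (Set.Ioi (q : ℂ).im) = _
      rw [← neg_inj, hvert, this]
    | coe q' =>
      have hqq : (q : ℝ) ≠ q' := by
        intro h
        exact hne (by rw [Rat.cast_injective h])
      have := arcIntegral_real_cusps hF f.continuous hqq hσ hσ' (f.decaysAtImInfty σ)
        (f.decaysAtImInfty σ') hΦ hΦ'
      rw [hcast, hcast] at this
      exact this

lemma HBar.act_inr_cusp (g σ : GL (Fin 2) ℤ) : HBar.act g (.inr (cusp σ)) = .inr (cusp (g * σ)) := by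
  rw [HBar.act, cusp, cusp, map_mul, mul_smul]

lemma cusp_mul_ne {σ τ : GL (Fin 2) ℤ} (h : τ 1 0 ≠ 0) : cusp σ ≠ cusp (σ * τ) := by
  rw [cusp, cusp, map_mul, mul_smul]
  intro he
  have := (MulAction.injective _ he).symm
  rw [OnePoint.smul_infty_eq_self_iff] at this
  simp [h] at this

/-- The symbol of an arc between two cusps on the sheet `gG`, as a difference of values of the
imaginary part of a primitive. -/
lemma sheetSymbol_cusps [G.FiniteIndex] (f : FirstKind G) {F : ℂ → ℂ}
    (hF : IsPrimitive F f) (g : GL (Fin 2) ℤ) {σ τ : GL (Fin 2) ℤ} (hτ : τ 1 0 ≠ 0) {Φ Φ' : ℂ}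
    (hΦ : Tendsto (fun z : ℍ => F ↑(toReal (g⁻¹ * σ) • z)) atImInfty (𝓝 Φ))
    (hΦ' : Tendsto (fun z : ℍ => F ↑(toReal (g⁻¹ * (σ * τ)) • z)) atImInfty (𝓝 Φ')) :
    sheetSymbol G g (.inr (cusp σ)) (.inr (cusp (σ * τ))) f = Φ'.im - Φ.im := by
  rw [sheetSymbol, modularSymbol, HBar.act_inr_cusp, HBar.act_inr_cusp,
    f.arcIntegral_cusps hF (by rw [← mul_assoc]; exact cusp_mul_ne hτ) hΦ hΦ', Complex.sub_im]

lemma sheetSymbol_coe (f : FirstKind G) {F : ℂ → ℂ} (hF : IsPrimitive F f) (g : GL (Fin 2) ℤ)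
    (z w : ℍ) : sheetSymbol G g (.inl z) (.inl w) f =
      (F ↑(toReal g⁻¹ • w)).im - (F ↑(toReal g⁻¹ • z)).im := by
  rw [← Complex.sub_im, ← arcIntegral_coe hF f.continuous]
  rfl


/-! ### The shift of continued fractions -/

/-- The orbit of `{β}` under the shift. -/
def cfOrbit (β : ℝ) (k : ℕ) : ℝ := gaussMap^[k] (Int.fract β)

lemma gaussMap_eq_fract (x : ℝ) : gaussMap x = Int.fract (1 / x) := rfl

lemma cfOrbit_succ (β : ℝ) (k : ℕ) : cfOrbit β (k + 1) = gaussMap (cfOrbit β k) :=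
  Function.iterate_succ_apply' _ _ _

lemma cfDigit_succ (β : ℝ) (k : ℕ) : cfDigit β (k + 1) = ⌊1 / cfOrbit β k⌋ := rfl

section orbit

variable {β : ℝ}

lemma fract_irrational {x : ℝ} (hx : Irrational x) : Irrational (Int.fract x) := by
  rw [← Int.self_sub_floor]
  exact hx.sub_intCast _

lemma cfOrbit_irrational (hβ : Irrational β) (k : ℕ) : Irrational (cfOrbit β k) := by
  induction k with
  | zero => exact fract_irrational hβ
  | succ k ih =>
    rw [cfOrbit_succ, gaussMap_eq_fract, one_div]
    exact fract_irrational ih.inv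

lemma cfOrbit_pos (hβ : Irrational β) (k : ℕ) : 0 < cfOrbit β k := by
  refine lt_of_le_of_ne ?_ (cfOrbit_irrational hβ k).ne_zero.symm
  cases k with
  | zero => exact Int.fract_nonneg _
  | succ k => rw [cfOrbit_succ, gaussMap_eq_fract]; exact Int.fract_nonneg _

lemma cfOrbit_lt_one (β : ℝ) (k : ℕ) : cfOrbit β k < 1 := by
  cases k with
  | zero => exact Int.fract_lt_one _
  | succ k => rw [cfOrbit_succ, gaussMap_eq_fract]; exact Int.fract_lt_one _

lemma one_div_cfOrbit (β : ℝ) (k : ℕ) :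
    1 / cfOrbit β k = cfDigit β (k + 1) + cfOrbit β (k + 1) := by
  rw [cfOrbit_succ, gaussMap_eq_fract, cfDigit_succ, Int.floor_add_fract]

lemma one_le_cfDigit_succ (hβ : Irrational β) (k : ℕ) : 1 ≤ cfDigit β (k + 1) := by
  rw [cfDigit_succ, Int.le_floor, Int.cast_one]
  exact (one_le_div (cfOrbit_pos hβ k)).mpr (cfOrbit_lt_one β k).le

/-- Write `1 = x (a + x')` with `a ≥ 1 > x'`. Single points of the orbit have no uniform bound below
`1`, but products of two consecutive ones do. -/
lemma cfOrbit_mul_succ_le (hβ : Irrational β) (k : ℕ) :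
    cfOrbit β k * cfOrbit β (k + 1) ≤ 1 / 2 := by
  have h0 := cfOrbit_pos hβ k
  have h1 := cfOrbit_lt_one β (k + 1)
  have hd : (1 : ℝ) ≤ cfDigit β (k + 1) := by exact_mod_cast one_le_cfDigit_succ hβ k
  have h := one_div_cfOrbit β k
  rw [div_eq_iff h0.ne'] at h
  nlinarith

/-- Two points of the orbit with the same subsequent partial quotients agree. -/
lemma cfOrbit_eq_of_cfDigit_eq (hβ : Irrational β) {i j : ℕ}
    (h : ∀ k, cfDigit β (i + k + 1) = cfDigit β (j + k + 1)) : cfOrbit β i = cfOrbit β j := by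
  have hstep : ∀ k, |cfOrbit β (i + k) - cfOrbit β (j + k)| =
      cfOrbit β (i + k) * cfOrbit β (j + k) * |cfOrbit β (i + (k + 1)) - cfOrbit β (j + (k + 1))| := by
    intro k
    have hi := cfOrbit_pos hβ (i + k)
    have hj := cfOrbit_pos hβ (j + k)
    have e1 := one_div_cfOrbit β (i + k)
    have e2 := one_div_cfOrbit β (j + k)
    rw [h k] at e1
    rw [div_eq_iff hi.ne'] at e1
    rw [div_eq_iff hj.ne'] at e2
    refine Eq.trans ?_ (congrArg (· * _) (abs_of_pos (mul_pos hi hj)))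
    rw [← abs_mul, ← add_assoc, ← add_assoc, abs_sub_comm]
    congr 1
    linear_combination cfOrbit β (j + k) * e1 - cfOrbit β (i + k) * e2
  -- Two applications of `hstep` give a factor that is a product of two consecutive pairs, hence at
  -- most `1/2 * 1/2`.
  have hbound : ∀ n k, |cfOrbit β (i + k) - cfOrbit β (j + k)| ≤ (1 / 4) ^ n := by
    intro n
    induction n with
    | zero =>
      intro k
      rw [pow_zero, abs_le]
      constructor <;>
        linarith [cfOrbit_pos hβ (i + k), cfOrbit_lt_one β (i + k), cfOrbit_pos hβ (j + k),
          cfOrbit_lt_one β (j + k)]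
    | succ n ih =>
      intro k
      rw [hstep k, hstep (k + 1)]
      have h1 := cfOrbit_mul_succ_le hβ (i + k)
      have h2 := cfOrbit_mul_succ_le hβ (j + k)
      have hx := cfOrbit_pos hβ (i + k)
      have hx' := cfOrbit_pos hβ (i + k + 1)
      have hy := cfOrbit_pos hβ (j + k)
      have hy' := cfOrbit_pos hβ (j + k + 1)
      have hprod := mul_le_mul h1 h2 (by positivity) (by norm_num)
      have := mul_le_mul hprod (ih (k + 1 + 1)) (abs_nonneg _) (by norm_num)
      rw [pow_succ']
      convert! this using 1 <;> ring_nf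
  have hlim := tendsto_pow_atTop_nhds_zero_of_lt_one (r := (1 / 4 : ℝ)) (by norm_num) (by norm_num)
  have := ge_of_tendsto' hlim fun n => hbound n 0
  exact sub_eq_zero.mp (abs_nonpos_iff.mp this)

lemma cfOrbit_add_of_eq {m l : ℕ} (h : cfOrbit β (m + l) = cfOrbit β m) {k : ℕ} (hk : m ≤ k) :
    cfOrbit β (k + l) = cfOrbit β k := by
  induction k, hk using Nat.le_induction with
  | base => exact h
  | succ k _ ih => rw [add_right_comm, cfOrbit_succ, cfOrbit_succ, ih]

/-- The product of the inverses of the first `k` points of the orbit. -/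
def cfMultiplier (β : ℝ) (k : ℕ) : ℝ := ∏ j ∈ Finset.range k, (cfOrbit β j)⁻¹

lemma cfMultiplier_pos (hβ : Irrational β) (k : ℕ) : 0 < cfMultiplier β k :=
  Finset.prod_pos fun j _ => inv_pos.mpr (cfOrbit_pos hβ j)

lemma cfMultiplier_succ (β : ℝ) (k : ℕ) :
    cfMultiplier β (k + 1) = cfMultiplier β k * (cfOrbit β k)⁻¹ :=
  Finset.prod_range_succ _ _

lemma cfMultiplier_lt (hβ : Irrational β) {m k : ℕ} (h : m < k) :
    cfMultiplier β m < cfMultiplier β k :=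
  strictMono_nat_of_lt_succ (fun k => by
    rw [cfMultiplier_succ]
    exact lt_mul_of_one_lt_right (cfMultiplier_pos hβ k)
      ((one_lt_inv₀ (cfOrbit_pos hβ k)).mpr (cfOrbit_lt_one β k))) h

lemma hasDerivAt_gaussMap {x : ℝ} (hx : Irrational x) : HasDerivAt gaussMap (-(x⁻¹ ^ 2)) x := by
  have hfl : ∀ᶠ y : ℝ in 𝓝 x, ⌊1 / y⌋ = ⌊1 / x⌋ := by
    have hc : ContinuousAt (fun y : ℝ => 1 / y) x :=
      continuousAt_const.div continuousAt_id hx.ne_zero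
    have hirr : Irrational (1 / x) := by rw [one_div]; exact hx.inv
    have hmem : 1 / x ∈ Set.Ioo (⌊1 / x⌋ : ℝ) (⌊1 / x⌋ + 1) :=
      ⟨lt_of_le_of_ne (Int.floor_le _) (hirr.ne_int _).symm, Int.lt_floor_add_one _⟩
    filter_upwards [hc.eventually (isOpen_Ioo.mem_nhds hmem)] with y hy
    exact Int.floor_eq_iff.mpr ⟨hy.1.le, hy.2⟩
  have hd : HasDerivAt (fun y : ℝ => 1 / y - ⌊1 / x⌋) (-(x⁻¹ ^ 2)) x := by
    simpa using (hasDerivAt_inv hx.ne_zero).sub_const (⌊1 / x⌋ : ℝ)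
  refine hd.congr_of_eventuallyEq ?_
  filter_upwards [hfl] with y hy
  rw [gaussMap, hy]

lemma hasDerivAt_iterate_gaussMap (hβ : Irrational β) (n : ℕ) :
    HasDerivAt gaussMap^[n] ((-1) ^ n * cfMultiplier β n ^ 2) (Int.fract β) := by
  induction n with
  | zero => simpa [cfMultiplier] using hasDerivAt_id (Int.fract β)
  | succ n ih =>
    rw [Function.iterate_succ']
    convert! HasDerivAt.comp (Int.fract β)
      (show HasDerivAt gaussMap (-((cfOrbit β n)⁻¹ ^ 2)) (gaussMap^[n] (Int.fract β)) from
        hasDerivAt_gaussMap (cfOrbit_irrational hβ n)) ih using 1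
    rw [cfMultiplier_succ]
    ring

end orbit

lemma bounded_of_eventually_periodic {D : ℕ → ℝ} {m l : ℕ} (hl : 0 < l)
    (h : ∀ n, m ≤ n → D (n + l) = D n) : ∃ B, ∀ n, |D n| ≤ B := by
  refine ⟨∑ j ∈ Finset.range (m + l), |D j|, fun n => ?_⟩
  induction n using Nat.strong_induction_on with
  | _ n ih =>
    rcases lt_or_ge n (m + l) with hn | hn
    · exact Finset.single_le_sum (f := fun j => |D j|) (fun j _ => abs_nonneg _)
        (Finset.mem_range.mpr hn)
    · have := h (n - l) (by omega)
      rw [Nat.sub_add_cancel (by omega)] at this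
      rw [this]
      exact ih _ (by omega)

/-- The Lyapunov exponent of an eventually periodic orbit. -/
lemma isLyapunovExponent_of_periodic {β : ℝ} (hβ : Irrational β) {m l : ℕ} (hl : 0 < l)
    (h : cfOrbit β (m + l) = cfOrbit β m) :
    IsLyapunovExponent (Int.fract β)
      (2 * Real.log (cfMultiplier β (m + l) / cfMultiplier β m) / l) := by
  set A := Real.log (cfMultiplier β (m + l) / cfMultiplier β m) with hA
  have hl0 : (l : ℝ) ≠ 0 := by exact_mod_cast hl.ne'
  have hratio : ∀ n, m ≤ n →
      cfMultiplier β (n + l) / cfMultiplier β n = cfMultiplier β (m + l) / cfMultiplier β m := by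
    intro n hn
    induction n, hn using Nat.le_induction with
    | base => rfl
    | succ n hn ih =>
      rw [add_right_comm, cfMultiplier_succ, cfMultiplier_succ, cfOrbit_add_of_eq h hn,
        mul_div_mul_right _ _ (inv_ne_zero (cfOrbit_pos hβ n).ne'), ih]
  -- The difference between `log |(Tⁿ)'|` and its linear growth is eventually periodic, hence
  -- bounded, and disappears after division by `n`.
  obtain ⟨B, hB⟩ := bounded_of_eventually_periodic
    (D := fun n => 2 * Real.log (cfMultiplier β n) - n * (2 * A / l)) hl fun n hn => by
      have h1 : Real.log (cfMultiplier β (n + l)) - Real.log (cfMultiplier β n) = A := by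
        rw [← Real.log_div (cfMultiplier_pos hβ _).ne' (cfMultiplier_pos hβ _).ne', hratio n hn]
      have h2 : (l : ℝ) * (2 * A / l) = 2 * A := by field_simp
      push_cast
      linear_combination 2 * h1 - h2
  have hzero : Tendsto (fun n : ℕ => (2 * Real.log (cfMultiplier β n) - n * (2 * A / l)) * (n : ℝ)⁻¹)
      atTop (𝓝 0) :=
    bdd_le_mul_tendsto_zero' B (.of_forall hB) tendsto_inv_atTop_nhds_zero_nat
  have hlim := hzero.add_const (2 * A / l)
  rw [zero_add] at hlim
  refine hlim.congr' ?_
  filter_upwards [eventually_gt_atTop 0] with n hn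
  have hn0 : (n : ℝ) ≠ 0 := by exact_mod_cast hn.ne'
  rw [(hasDerivAt_iterate_gaussMap hβ n).deriv, abs_mul, abs_pow, abs_neg, abs_one, one_pow,
    one_mul, abs_of_pos (pow_pos (cfMultiplier_pos hβ n) 2), Real.log_pow]
  push_cast
  field_simp
  ring

/-! ### Matrices of convergents and periods of the shift -/

lemma mulVec_cons_cons (A : Matrix (Fin 2) (Fin 2) ℝ) (x y : ℝ) :
    A.mulVec ![x, y] = ![A 0 0 * x + A 0 1 * y, A 1 0 * x + A 1 1 * y] := by
  ext i
  fin_cases i <;> simp [Matrix.mulVec, dotProduct, Fin.sum_univ_two]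

/-- This is `β = g_k(x_k)` with the scalar recorded: `(0 1; 1 a)` sends `(x_{k+1}, 1)` to `(1,
1/x_k) = x_k⁻¹ (x_k, 1)`. The scalar is what links eigenvalues to the Lyapunov exponent. -/
lemma mulVec_cfMatrix {β : ℝ} (hβ : Irrational β) (k : ℕ) :
    (toReal (cfMatrix β k)).val.mulVec ![cfOrbit β k, 1] = cfMultiplier β k • ![β, 1] := by
  induction k with
  | zero =>
    have : Int.fract β + ⌊β⌋ = β := by rw [add_comm]; exact Int.floor_add_fract β
    rw [mulVec_cons_cons]
    simp [cfMatrix, cfTranslate, cfOrbit, cfMultiplier, cfDigit, this]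
  | succ k ih =>
    have h0 := (cfOrbit_pos hβ k).ne'
    have hstep : (toReal (cfStep (cfDigit β (k + 1)))).val.mulVec ![cfOrbit β (k + 1), 1] =
        (cfOrbit β k)⁻¹ • ![cfOrbit β k, 1] := by
      have h := one_div_cfOrbit β k
      rw [one_div] at h
      rw [mulVec_cons_cons]
      simp [cfStep, h, add_comm]
      rw [← h, inv_mul_cancel₀ h0]
    rw [cfMatrix, toReal, map_mul, Units.val_mul, ← Matrix.mulVec_mulVec, ← toReal, ← toReal, hstep,
      Matrix.mulVec_smul, ih, cfMultiplier_succ, smul_smul, mul_comm]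

variable {G : Subgroup PGL(2, ℤ)}

lemma iterate_shift (g : GL (Fin 2) ℤ) (β : ℝ) (k : ℕ) :
    (shift G)^[k] (startPoint G g β) = (cfOrbit β k,
      ((Matrix.ProjGenLinGroup.mk ((cfMatrix β k)⁻¹ * g) : PGL(2, ℤ)) : Cosets G)) := by
  induction k with
  | zero => simp [startPoint, cfOrbit, cfMatrix, cfDigit]
  | succ k ih =>
    rw [Function.iterate_succ_apply', ih, shift, cfOrbit_succ, cfMatrix, mul_inv_rev, mul_assoc,
      map_mul _ (cfStep _)⁻¹, cfDigit_succ]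
    rfl

/-- The matrix carrying the `m`-th to the `(m + l)`-th pair of convergents. -/
def periodMatrix (β : ℝ) (m l : ℕ) : GL (Fin 2) ℤ := cfMatrix β (m + l) * (cfMatrix β m)⁻¹

/-- The cosets of `g_{m+l}⁻¹ g` and `g_m⁻¹ g` agree exactly when `g⁻¹ g_{m+l} g_m⁻¹ g` lies in `G`.
-/
lemma iterate_shift_eq_iff (g : GL (Fin 2) ℤ) (β : ℝ) (m l : ℕ) :
    (shift G)^[m + l] (startPoint G g β) = (shift G)^[m] (startPoint G g β) ↔
      cfOrbit β (m + l) = cfOrbit β m ∧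
        Matrix.ProjGenLinGroup.mk (g⁻¹ * periodMatrix β m l * g) ∈ G := by
  rw [iterate_shift, iterate_shift, Prod.mk.injEq, QuotientGroup.eq, ← map_inv, ← map_mul]
  simp [periodMatrix, mul_assoc]

/-- Both `g_m` and `g_{m+l}` carry the same vector `(x_m, 1)` to a multiple of `(β, 1)`. -/
lemma mulVec_periodMatrix {β : ℝ} (hβ : Irrational β) {m l : ℕ}
    (h : cfOrbit β (m + l) = cfOrbit β m) :
    (toReal (periodMatrix β m l)).val.mulVec ![β, 1] =
      (cfMultiplier β (m + l) / cfMultiplier β m) • ![β, 1] := by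
  have h1 := mulVec_cfMatrix hβ m
  have h2 := mulVec_cfMatrix hβ (m + l)
  rw [h] at h2
  have hm := (cfMultiplier_pos hβ m).ne'
  have h3 : (toReal (cfMatrix β m)⁻¹).val.mulVec ![β, 1] =
      (cfMultiplier β m)⁻¹ • ![cfOrbit β m, 1] := by
    have h4 : (![β, 1] : Fin 2 → ℝ) = (cfMultiplier β m)⁻¹ •
        (toReal (cfMatrix β m)).val.mulVec ![cfOrbit β m, 1] := by
      rw [h1, smul_smul, inv_mul_cancel₀ hm, one_smul]
    rw [h4, Matrix.mulVec_smul, Matrix.mulVec_mulVec, ← Units.val_mul, toReal, toReal, ← map_mul,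
      inv_mul_cancel, map_one, Units.val_one, Matrix.one_mulVec]
  rw [periodMatrix, toReal, map_mul, Units.val_mul, ← Matrix.mulVec_mulVec, ← toReal, ← toReal, h3,
    Matrix.mulVec_smul, h2, smul_smul]
  congr 1
  ring

/-- Along `N + j d` the real coordinate is constant, and the other takes values in the finite set
`ℙ`, so two indices collide. -/
lemma exists_iterate_shift_eq [G.FiniteIndex] (g : GL (Fin 2) ℤ) {β : ℝ} (hβ : Irrational β)
    (hper : EventuallyPeriodicCF β) :
    ∃ m l : ℕ, 0 < l ∧
      (shift G)^[m + l] (startPoint G g β) = (shift G)^[m] (startPoint G g β) := by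
  obtain ⟨N, d, hd, h⟩ := hper
  have hstep : ∀ j, cfOrbit β (N + j * d) = cfOrbit β N := by
    intro j
    induction j with
    | zero => simp
    | succ j ih =>
      rw [← ih]
      refine cfOrbit_eq_of_cfDigit_eq hβ fun k => ?_
      rw [← h (N + j * d + k + 1) (by omega)]
      rw [show N + (j + 1) * d + k + 1 = N + j * d + k + 1 + d by ring]
  obtain ⟨i, j, hne, hij⟩ := Finite.exists_ne_map_eq_of_infinite fun j : ℕ =>
    ((Matrix.ProjGenLinGroup.mk ((cfMatrix β (N + j * d))⁻¹ * g) : PGL(2, ℤ)) : Cosets G)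
  wlog hlt : i < j generalizing i j
  · exact this j i hne.symm hij.symm (by omega)
  have hmul : i * d < j * d := Nat.mul_lt_mul_of_pos_right hlt hd
  refine ⟨N + i * d, j * d - i * d, by omega, ?_⟩
  rw [show N + i * d + (j * d - i * d) = N + j * d by omega, iterate_shift, iterate_shift, hstep,
    hstep, hij]

lemma convergent_eq_cusp (β : ℝ) (k : ℕ) :
    convergent β k = .inr (cusp (cfMatrix β k * cfStep 0)) := by
  have : ((0 : ℚ) : OnePoint ℚ) = cusp (cfStep 0) := by
    simp [cusp, OnePoint.smul_infty_eq_ite, cfStep]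
  rw [convergent, this, HBar.act_inr_cusp]

/-- The symbols of successive convergents over a period add up to the period of `Im F`. -/
lemma sum_sheetSymbol_convergent [G.FiniteIndex] (f : FirstKind G) {F : ℂ → ℂ}
    (hF : IsPrimitive F f) (g : GL (Fin 2) ℤ) {β : ℝ} {m l : ℕ}
    (h : Matrix.ProjGenLinGroup.mk (g⁻¹ * periodMatrix β m l * g) ∈ G) (w : ℍ) :
    ∑ k ∈ Finset.Icc (m + 1) (m + l),
        sheetSymbol G g (convergent β (k - 1)) (convergent β k) f =
      (F ↑(toReal (g⁻¹ * periodMatrix β m l * g) • w)).im - (F w).im := by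
  choose Φ hΦ using fun k => f.exists_tendsto hF (g⁻¹ * (cfMatrix β k * cfStep 0))
  have hsym : ∀ k, sheetSymbol G g (convergent β k) (convergent β (k + 1)) f =
      (Φ (k + 1)).im - (Φ k).im := by
    intro k
    -- The right-hand factor is `(a 1; 1 0)`; its lower left entry `1` shows that consecutive
    -- convergents are distinct cusps.
    have hmul : cfMatrix β (k + 1) * cfStep 0 =
        cfMatrix β k * cfStep 0 * (cfStep 0 * cfStep (cfDigit β (k + 1)) * cfStep 0) := by
      have : cfStep 0 * cfStep 0 = 1 := by
        ext i j
        fin_cases i <;> fin_cases j <;> simp [cfStep, Matrix.mul_apply]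
      calc _ = cfMatrix β k * (cfStep 0 * cfStep 0) * cfStep (cfDigit β (k + 1)) * cfStep 0 := by
            rw [this, mul_one, cfMatrix]
        _ = _ := by simp only [mul_assoc]
    have hΦ' := hΦ (k + 1)
    rw [hmul] at hΦ'
    rw [convergent_eq_cusp, convergent_eq_cusp, hmul]
    exact sheetSymbol_cusps f hF g (by simp [cfStep, Matrix.mul_apply]) (hΦ k) hΦ'
  have hsum : ∑ k ∈ Finset.Icc (m + 1) (m + l),
      sheetSymbol G g (convergent β (k - 1)) (convergent β k) f = (Φ (m + l)).im - (Φ m).im := by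
    rw [← Finset.Ico_succ_right_eq_Icc, Finset.sum_Ico_eq_sum_range]
    have : Order.succ (m + l) - (m + 1) = l := by rw [Order.succ_eq_add_one]; omega
    rw [this]
    refine Eq.trans ?_ (Finset.sum_range_sub (fun j => (Φ (m + j)).im) l)
    refine Finset.sum_congr rfl fun j _ => ?_
    rw [show m + 1 + j = m + j + 1 by ring, Nat.add_sub_cancel, hsym, add_assoc]
  rw [hsum]
  -- The period matrix carries the approach to the `m`-th cusp to the approach to the `(m + l)`-th,
  -- so the difference of `Im F` is already constant before the limit.
  have hlim := ((Complex.continuous_im.tendsto _).comp (hΦ (m + l))).sub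
    ((Complex.continuous_im.tendsto _).comp (hΦ m))
  refine tendsto_nhds_unique hlim (tendsto_const_nhds.congr fun z => ?_)
  have := f.im_smul_sub_im hF h w (toReal (g⁻¹ * (cfMatrix β m * cfStep 0)) • z)
  rw [this, ← mul_smul, toReal, toReal, ← map_mul]
  simp only [Function.comp_apply, periodMatrix]
  congr 5
  group


/-! ### Growth of quasi-periodic functions along geodesics -/

lemma re_smul_of_upperTriangular {N : GL (Fin 2) ℝ} (h : N 1 0 = 0) (z : ℍ) :
    (N • z).re = N 0 0 / N 1 1 * z.re + N 0 1 / N 1 1 := by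
  rw [re_smul]
  simp only [num, denom, h, Complex.ofReal_zero, zero_mul, zero_add, Complex.div_ofReal_re]
  simp
  ring

lemma im_smul_of_upperTriangular {N : GL (Fin 2) ℝ} (h : N 1 0 = 0) (z : ℍ) :
    (N • z).im = |N 0 0 / N 1 1| * z.im := by
  rw [im_smul]
  simp only [num, denom, h, Complex.ofReal_zero, zero_mul, zero_add, Complex.div_ofReal_im]
  simp [abs_div, abs_mul, abs_of_pos z.im_pos]
  ring

/-- A continuous function on the half plane that changes by `-P` under a contraction fixing `∞`
with multiplier `e^{-L}` grows like `τ P / L` along vertical lines. -/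
lemma tendsto_of_quasiperiodic {V : ℍ → ℝ} (hV : Continuous V) {N : GL (Fin 2) ℝ}
    (hN : N 1 0 = 0) {L P : ℝ} (hL : 0 < L) (hNL : |N 0 0 / N 1 1| = Real.exp (-L))
    (hP : ∀ w, V (N • w) = V w - P) {a b : ℝ} (hb : 0 < b) {y : ℝ → ℍ}
    (hy : ∀ᶠ τ in atTop, (y τ).re = a ∧ (y τ).im = b * Real.exp τ) :
    Tendsto (fun τ => 1 / τ * V (y τ)) atTop (𝓝 (P / L)) := by
  have hρ : Real.exp (-L) < 1 := by
    rw [← Real.exp_zero]; exact Real.exp_lt_exp.mpr (by linarith)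
  -- With `ρ = e^{-L}` and `t = N 0 1 / N 1 1`, one has `ρ R + |t| ≤ R`. The strip `|re| ≤ R` is
  -- therefore stable under `N`, and it contains the line `re = a`.
  set R := max |a| (|N 0 1 / N 1 1| / (1 - Real.exp (-L))) with hR
  have hstrip : ∀ w : ℍ, |w.re| ≤ R → |(N • w).re| ≤ R := by
    intro w hw
    rw [re_smul_of_upperTriangular hN]
    have h1 : |N 0 1 / N 1 1| ≤ R * (1 - Real.exp (-L)) :=
      (div_le_iff₀ (by linarith)).mp (le_max_right _ _)
    refine (abs_add_le _ _).trans ?_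
    rw [abs_mul, hNL]
    have := mul_le_mul_of_nonneg_left hw (Real.exp_pos (-L)).le
    linarith
  have hpow : ∀ (n : ℕ) (w : ℍ), |w.re| ≤ R → |(N ^ n • w).re| ≤ R ∧
      (N ^ n • w).im = Real.exp (-(n * L)) * w.im ∧ V (N ^ n • w) = V w - n * P := by
    intro n w hw
    induction n with
    | zero => simpa using hw
    | succ n ih =>
      obtain ⟨h1, h2, h3⟩ := ih
      rw [pow_succ', mul_smul]
      refine ⟨hstrip _ h1, ?_, ?_⟩
      · rw [im_smul_of_upperTriangular hN, h2, hNL, ← mul_assoc, ← Real.exp_add]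
        push_cast
        ring_nf
      · rw [hP, h3]
        push_cast
        ring
  obtain ⟨B, hB⟩ := (isCompact_Icc (a := -R) (b := R) |>.prod
    (isCompact_Icc (a := b) (b := b * Real.exp L))).exists_bound_of_continuousOn
    (f := fun p : ℝ × ℝ => V (ofComplex (p.1 + p.2 * Complex.I)))
    ((continuousOn_comp_ofComplex hV).comp (f := fun p : ℝ × ℝ => (p.1 : ℂ) + p.2 * Complex.I)
      (by fun_prop) fun p hp => by
        have := hp.2.1
        simp only [Set.mem_ofPred_eq, Complex.add_im, Complex.ofReal_im, Complex.mul_im,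
          Complex.ofReal_re, Complex.I_im, Complex.I_re]
        linarith)
  have hbound : ∀ᶠ τ in atTop, ‖V (y τ) - τ * (P / L)‖ ≤ B + |P| := by
    filter_upwards [hy, eventually_ge_atTop 0] with τ hτ h0
    -- With this exponent `N ^ n` brings `y τ` into the compact rectangle on which `B` bounds `V`,
    -- and `|n - τ / L| ≤ 1`.
    set n := ⌊τ / L⌋₊ with hn
    have hn1 : (n : ℝ) ≤ τ / L := Nat.floor_le (by positivity)
    have hn2 : τ / L < n + 1 := Nat.lt_floor_add_one _
    have hn1' : n * L ≤ τ := (le_div_iff₀ hL).mp hn1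
    have hn2' : τ < (n + 1) * L := (div_lt_iff₀ hL).mp hn2
    obtain ⟨h1, h2, h3⟩ := hpow n (y τ) (by rw [hτ.1]; exact le_max_left _ _)
    set w := N ^ n • y τ
    have him : w.im = b * Real.exp (τ - n * L) := by
      rw [h2, hτ.2, sub_eq_add_neg, Real.exp_add]; ring
    have hw := hB (w.re, w.im) ⟨abs_le.mp h1, by
      rw [him]
      exact ⟨le_mul_of_one_le_right hb.le (Real.one_le_exp (by linarith)),
        mul_le_mul_of_nonneg_left (Real.exp_le_exp.mpr (by linarith)) hb.le⟩⟩
    have hcoe : ofComplex ((w.re : ℂ) + w.im * Complex.I) = w := by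
      have : (w.re : ℂ) + w.im * Complex.I = w := by
        simpa using Complex.re_add_im (w : ℂ)
      rw [this, ofComplex_apply]
    rw [hcoe] at hw
    have e : V (y τ) - τ * (P / L) = V w + (n - τ / L) * P := by rw [h3]; ring
    rw [e]
    refine (norm_add_le _ _).trans (add_le_add hw ?_)
    rw [norm_mul, Real.norm_eq_abs, Real.norm_eq_abs]
    exact mul_le_of_le_one_left (abs_nonneg _) (abs_le.mpr ⟨by linarith, by linarith⟩)
  have hzero := (bdd_le_mul_tendsto_zero' (B + |P|) hbound tendsto_inv_atTop_zero).add_const (P / L)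
  rw [zero_add] at hzero
  refine hzero.congr' ?_
  filter_upwards [eventually_gt_atTop 0] with τ hτ
  field_simp
  ring

/-- The matrix of `z ↦ 1 / (β - z)`, which carries `β` to `∞`. -/
def toInfinity (β : ℝ) : SL(2, ℝ) := ⟨!![0, 1; -1, β], by simp⟩

lemma coe_toInfinity_smul (β : ℝ) (z : ℍ) : (↑(toInfinity β • z) : ℂ) = 1 / (β - z) := by
  rw [coe_specialLinearGroup_apply]
  simp [toInfinity]
  ring

lemma re_toInfinity_smul (β : ℝ) (z : ℍ) :
    (toInfinity β • z).re = (β - z.re) / ((z.re - β) ^ 2 + z.im ^ 2) := by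
  rw [← coe_re, coe_toInfinity_smul, Complex.div_re]
  simp [Complex.normSq_apply]
  ring

lemma im_toInfinity_smul (β : ℝ) (z : ℍ) :
    (toInfinity β • z).im = z.im / ((z.re - β) ^ 2 + z.im ^ 2) := by
  rw [← coe_im, coe_toInfinity_smul, Complex.div_im]
  simp [Complex.normSq_apply]
  ring

lemma exists_re_toInfinity_smul {α : OnePoint ℝ} {β : ℝ} (hα : α ≠ (β : OnePoint ℝ)) :
    ∃ a, ∀ z ∈ geodesicLine α β, (toInfinity β • z).re = a := by
  induction α using OnePoint.rec with
  | infty =>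
    refine ⟨0, fun z hz => ?_⟩
    have hz' : z.re = β := hz
    rw [re_toInfinity_smul, hz']
    simp
  | coe α =>
    have hne : α ≠ β := fun h => hα (by rw [h])
    refine ⟨1 / (β - α), fun z hz => ?_⟩
    have hz' : (z.re - α) * (z.re - β) + z.im ^ 2 = 0 := hz
    have h1 : β - α ≠ 0 := sub_ne_zero.mpr hne.symm
    have h2 : (z.re - β) ^ 2 + z.im ^ 2 ≠ 0 := by
      have := z.im_pos
      positivity
    rw [re_toInfinity_smul, div_eq_div_iff h2 h1]
    linear_combination -hz'

/-- In the coordinate `1 / (β - z)` a geodesic towards `β` is a vertical half line, parametrized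
exponentially by the hyperbolic distance. -/
lemma geodesic_coordinates {α : OnePoint ℝ} {β : ℝ} {x₀ : ℍ} {y : ℝ → ℍ}
    (hα : α ≠ (β : OnePoint ℝ)) (hx₀ : x₀ ∈ geodesicLine α β)
    (hy : ∀ τ : ℝ, 0 ≤ τ → y τ ∈ geodesicLine α β ∧ dist x₀ (y τ) = τ)
    (hlim : Tendsto (fun τ => (y τ : ℂ)) atTop (𝓝 (β : ℂ))) :
    ∃ a b, 0 < b ∧ ∀ᶠ τ in atTop, (toInfinity β • y τ).re = a ∧
      (toInfinity β • y τ).im = b * Real.exp τ := by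
  obtain ⟨a, ha⟩ := exists_re_toInfinity_smul hα
  set b := (toInfinity β • x₀).im with hb
  have hbpos : 0 < b := im_pos _
  refine ⟨a, b, hbpos, ?_⟩
  have hD : Tendsto (fun τ => ((y τ).re - β) ^ 2 + (y τ).im ^ 2) atTop (𝓝 0) := by
    have hre := (Complex.continuous_re.tendsto _).comp hlim
    have him := (Complex.continuous_im.tendsto _).comp hlim
    simpa using ((hre.sub_const β).pow 2).add (him.pow 2)
  filter_upwards [eventually_ge_atTop 0,
    hD.eventually (gt_mem_nhds (show 0 < 1 / (a ^ 2 + b ^ 2) by positivity))] with τ h0 hτ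
  obtain ⟨hmem, hdist⟩ := hy τ h0
  refine ⟨ha _ hmem, ?_⟩
  have hpos : 0 < ((y τ).re - β) ^ 2 + (y τ).im ^ 2 := by
    have := (y τ).im_pos
    positivity
  -- The distance determines `log im` only up to reflection in `log b`. Convergence to `β` selects
  -- the upper branch: `a² + im²` is the inverse squared distance to `β`, which eventually exceeds
  -- `a² + b²`.
  have hge : b ≤ (toInfinity β • y τ).im := by
    refine (sq_le_sq₀ hbpos.le (im_pos _).le).mp ?_
    have h1 : (toInfinity β • y τ).im ^ 2 = 1 / (((y τ).re - β) ^ 2 + (y τ).im ^ 2) - a ^ 2 := by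
      rw [← ha _ hmem, re_toInfinity_smul, im_toInfinity_smul]
      field_simp
      ring
    rw [lt_div_iff₀ (by positivity)] at hτ
    have : a ^ 2 + b ^ 2 ≤ 1 / (((y τ).re - β) ^ 2 + (y τ).im ^ 2) := by
      rw [le_div_iff₀ hpos]; linarith
    linarith
  have hd : dist (toInfinity β • x₀) (toInfinity β • y τ) = τ := by rw [dist_smul, hdist]
  rw [dist_of_re_eq (by rw [ha _ hx₀, ha _ hmem]), dist_comm, Real.dist_eq,
    abs_of_nonneg (sub_nonneg.mpr (Real.log_le_log hbpos hge))] at hd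
  rw [← Real.exp_log (im_pos (toInfinity β • y τ)), ← Real.exp_log hbpos, ← Real.exp_add]
  congr 1
  linarith

/-- The vertical geodesic towards `β`. -/
lemma verticalGeodesic (β : ℝ) : ∃ (x₀ : ℍ) (y : ℝ → ℍ),
    x₀ ∈ geodesicLine OnePoint.infty β ∧
    (∀ τ : ℝ, 0 ≤ τ → y τ ∈ geodesicLine OnePoint.infty β ∧ dist x₀ (y τ) = τ) ∧
    Tendsto (fun τ => (y τ : ℂ)) atTop (𝓝 (β : ℂ)) := by
  refine ⟨⟨⟨β, 1⟩, one_pos⟩, fun τ => ⟨⟨β, Real.exp (-τ)⟩, Real.exp_pos _⟩, rfl,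
    fun τ h0 => ⟨rfl, ?_⟩, ?_⟩
  · refine (dist_of_re_eq (z := ⟨⟨β, 1⟩, one_pos⟩) (w := ⟨⟨β, Real.exp (-τ)⟩, Real.exp_pos _⟩)
      rfl).trans ?_
    change dist (Real.log 1) (Real.log (Real.exp (-τ))) = τ
    rw [Real.log_one, Real.log_exp, Real.dist_eq, zero_sub, neg_neg, abs_of_nonneg h0]
  · have h1 : Tendsto (fun τ : ℝ => (β : ℂ) + (Real.exp (-τ) : ℝ) * Complex.I) atTop (𝓝 β) := by
      have := ((Complex.continuous_ofReal.tendsto 0).comp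
        (Real.tendsto_exp_neg_atTop_nhds_zero)).mul_const Complex.I
      simpa using this.const_add (β : ℂ)
    refine h1.congr fun τ => ?_
    apply Complex.ext <;> simp [-Complex.ofReal_exp]

/-! ### The limit along geodesics -/

variable {G : Subgroup PGL(2, ℤ)}

lemma abs_det_toReal (σ : GL (Fin 2) ℤ) : |(toReal σ).det.val| = 1 := by
  have h : (toReal σ).det.val = ((σ.det.val : ℤ) : ℝ) := by
    rw [toReal, Matrix.GeneralLinearGroup.map_det]
    simp
  rw [h]
  rcases Int.units_eq_one_or σ.det with h | h <;> simp [h]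

/-- Since `h` attracts towards `β`, its inverse becomes a contraction `N` fixing `∞` once `β` is
moved there. Its diagonal entries are `μ⁻¹` and `± μ` because `|det| = 1`, hence the rate `2 log μ`.
The starting point `x` contributes a constant, which division by `τ` removes. -/
lemma tendsto_sheetSymbol (f : FirstKind G) {F : ℂ → ℂ} (hF : IsPrimitive F f)
    (g : GL (Fin 2) ℤ) {β μ P : ℝ} (hμ : 1 < μ) {h : GL (Fin 2) ℤ}
    (hh : (toReal h).val.mulVec ![β, 1] = μ • ![β, 1])
    (hP : ∀ w : ℍ, (F ↑(toReal (g⁻¹ * h * g) • w)).im - (F w).im = P)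
    {α : OnePoint ℝ} {x x₀ : ℍ} {y : ℝ → ℍ}
    (hα : α ≠ (β : OnePoint ℝ)) (hx₀ : x₀ ∈ geodesicLine α β)
    (hy : ∀ τ : ℝ, 0 ≤ τ → y τ ∈ geodesicLine α β ∧ dist x₀ (y τ) = τ)
    (hlim : Tendsto (fun τ => (y τ : ℂ)) atTop (𝓝 (β : ℂ))) :
    Tendsto (fun τ : ℝ => 1 / τ * sheetSymbol G g (.inl x) (.inl (y τ)) f) atTop
      (𝓝 (P / (2 * Real.log μ))) := by
  obtain ⟨a, b, hb, hab⟩ := geodesic_coordinates hα hx₀ hy hlim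
  set T : GL (Fin 2) ℝ := Matrix.SpecialLinearGroup.mapGL ℝ (toInfinity β) with hT
  have hTsmul : ∀ z : ℍ, toInfinity β • z = T • z := fun z => rfl
  simp_rw [hTsmul] at hab
  set V : ℍ → ℝ := fun w => (F ↑(toReal g⁻¹ • T⁻¹ • w)).im with hV
  have hVc : Continuous V := by
    refine Complex.continuous_im.comp (hF.continuous_comp_coe.comp ?_)
    exact (continuous_const_smul (toReal g⁻¹)).comp (continuous_const_smul T⁻¹)
  set N : GL (Fin 2) ℝ := T * toReal h⁻¹ * T⁻¹ with hNdef
  have hμ0 : μ ≠ 0 := by linarith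
  have hTe : T⁻¹.val.mulVec ![1, 0] = ![β, 1] := by
    have h1 : T.val.mulVec ![β, 1] = ![1, 0] := by
      have hTval : T.val = !![0, 1; -1, β] := by
        rw [hT, Matrix.SpecialLinearGroup.mapGL_coe_matrix]
        rfl
      rw [mulVec_cons_cons, hTval]
      simp
    rw [← h1, Matrix.mulVec_mulVec, ← Units.val_mul, inv_mul_cancel, Units.val_one,
      Matrix.one_mulVec]
  have hT1 : T.val.mulVec ![β, 1] = ![1, 0] := by
    rw [← hTe, Matrix.mulVec_mulVec, ← Units.val_mul, mul_inv_cancel, Units.val_one,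
      Matrix.one_mulVec]
  have hhinv : (toReal h⁻¹).val.mulVec ![β, 1] = μ⁻¹ • ![β, 1] := by
    have h1 : (![β, 1] : Fin 2 → ℝ) = μ⁻¹ • (toReal h).val.mulVec ![β, 1] := by
      rw [hh, smul_smul, inv_mul_cancel₀ hμ0, one_smul]
    conv_lhs => rw [h1]
    rw [Matrix.mulVec_smul, Matrix.mulVec_mulVec, ← Units.val_mul, toReal, toReal, ← map_mul,
      inv_mul_cancel, map_one, Units.val_one, Matrix.one_mulVec]
  have hNe : N.val.mulVec ![1, 0] = μ⁻¹ • ![1, 0] := by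
    rw [hNdef, Units.val_mul, Units.val_mul, ← Matrix.mulVec_mulVec, ← Matrix.mulVec_mulVec, hTe,
      hhinv, Matrix.mulVec_smul, hT1]
  rw [mulVec_cons_cons] at hNe
  have hN00 : N 0 0 = μ⁻¹ := by simpa using congrFun hNe 0
  have hN10 : N 1 0 = 0 := by simpa using congrFun hNe 1
  have hdet : |N.det.val| = 1 := by
    have : N.det = (toReal h⁻¹).det := by
      rw [hNdef, map_mul, map_mul, map_inv]
      exact mul_inv_cancel_comm _ _
    rw [this, abs_det_toReal]
  have hN11 : |N 1 1| = μ := by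
    rw [Matrix.GeneralLinearGroup.val_det_apply, Matrix.det_fin_two, hN10, mul_zero, sub_zero,
      hN00, abs_mul, abs_of_pos (by positivity)] at hdet
    field_simp at hdet
    exact hdet
  have hlog : 0 < Real.log μ := Real.log_pos hμ
  have hNL : |N 0 0 / N 1 1| = Real.exp (-(2 * Real.log μ)) := by
    rw [abs_div, hN00, hN11, abs_of_pos (by positivity), Real.exp_neg, two_mul, Real.exp_add,
      Real.exp_log (by linarith)]
    field_simp
  have hVN : ∀ w, V (N • w) = V w - P := by
    intro w
    have e : toReal g⁻¹ • T⁻¹ • w =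
        toReal (g⁻¹ * h * g) • toReal g⁻¹ • T⁻¹ • N • w := by
      simp only [← mul_smul, hNdef, toReal, map_mul, map_inv]
      congr 1
      group
    have := hP (toReal g⁻¹ • T⁻¹ • N • w)
    rw [← e] at this
    linarith
  have key := tendsto_of_quasiperiodic hVc hN10 (by positivity) hNL hVN hb hab
  have hconst := (tendsto_inv_atTop_zero (𝕜 := ℝ)).mul_const (F ↑(toReal g⁻¹ • x)).im
  have hsub := key.sub hconst
  rw [zero_mul, sub_zero] at hsub
  refine hsub.congr fun τ => ?_
  rw [sheetSymbol_coe f hF, hV]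
  simp only [inv_smul_smul]
  ring

/-- The real homology class of the image of the arc `⟨z, w⟩`, for `z, w` in the half plane. -/
def arcClass (G : Subgroup PGL(2, ℤ)) (z w : ℍ) : H1 G where
  toFun := modularSymbol G (.inl z) (.inl w)
  map_add' f f' := by
    obtain ⟨F, hF⟩ := exists_isPrimitive (CuspFormClass.holo f)
    obtain ⟨F', hF'⟩ := exists_isPrimitive (CuspFormClass.holo f')
    have hadd : IsPrimitive (F + F') ⇑(f + f') := hF.add hF'
    simp only [modularSymbol, HBar.toSphere]
    rw [arcIntegral_coe hadd (f + f').continuous, arcIntegral_coe hF f.continuous,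
      arcIntegral_coe hF' f'.continuous]
    simp
    ring
  map_smul' r f := by
    obtain ⟨F, hF⟩ := exists_isPrimitive (CuspFormClass.holo f)
    have hsmul : IsPrimitive (r • F) ⇑(r • f) := hF.real_smul r
    simp only [modularSymbol, HBar.toSphere]
    rw [arcIntegral_coe hsmul (r • f).continuous, arcIntegral_coe hF f.continuous]
    simp
    ring

lemma arcClass_apply (f : FirstKind G) {F : ℂ → ℂ} (hF : IsPrimitive F f) (z w : ℍ) :
    arcClass G z w f = (F w).im - (F z).im := by
  rw [← Complex.sub_im, ← arcIntegral_coe hF f.continuous]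
  rfl

end LimSymb

end

theorem lemma2p2 (G : Subgroup PGL(2, ℤ)) [G.FiniteIndex] (g : GL (Fin 2) ℤ)
    (β : ℝ) (hβ : Irrational β) (hper : LimSymb.EventuallyPeriodicCF β) :
    ∃ (lam : ℝ) (c : LimSymb.H1 G),
      LimSymb.IsLyapunovExponent (Int.fract β) lam ∧ 0 < lam ∧
      LimSymb.IsLimitingModularSymbol G g β c ∧
      (∃ m l : ℕ, 0 < l ∧
        (LimSymb.shift G)^[m + l] (LimSymb.startPoint G g β) =
          (LimSymb.shift G)^[m] (LimSymb.startPoint G g β)) ∧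
      ∀ m l : ℕ, 0 < l →
        (LimSymb.shift G)^[m + l] (LimSymb.startPoint G g β) =
          (LimSymb.shift G)^[m] (LimSymb.startPoint G g β) →
        ∀ f : LimSymb.FirstKind G,
          c f = (∑ k ∈ Finset.Icc (m + 1) (m + l),
            LimSymb.sheetSymbol G g (LimSymb.convergent β (k - 1)) (LimSymb.convergent β k) f) /
              (lam * l) := by
  have hmult : ∀ m l : ℕ, 0 < l →
      1 < LimSymb.cfMultiplier β (m + l) / LimSymb.cfMultiplier β m := fun m l hl =>
    (one_lt_div (LimSymb.cfMultiplier_pos hβ m)).mpr (LimSymb.cfMultiplier_lt hβ (by omega))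
  obtain ⟨m₀, l₀, hl₀, hs₀⟩ := LimSymb.exists_iterate_shift_eq (G := G) g hβ hper
  obtain ⟨horb₀, hmem₀⟩ := (LimSymb.iterate_shift_eq_iff g β m₀ l₀).mp hs₀
  have hlyap := LimSymb.isLyapunovExponent_of_periodic hβ hl₀ horb₀
  set μ₀ := LimSymb.cfMultiplier β (m₀ + l₀) / LimSymb.cfMultiplier β m₀ with hμ₀
  have hlog₀ : 0 < Real.log μ₀ := Real.log_pos (hmult m₀ l₀ hl₀)
  set γ := LimSymb.toReal (g⁻¹ * LimSymb.periodMatrix β m₀ l₀ * g) with hγ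
  -- The period `P` of `Im F` under `γ` is the integral over the arc from `i` to `γ i`. In this form
  -- it is visibly linear in `f`; the base point `i` is arbitrary.
  have hlimit : LimSymb.IsLimitingModularSymbol G g β
      ((2 * Real.log μ₀)⁻¹ • LimSymb.arcClass G UpperHalfPlane.I (γ • UpperHalfPlane.I)) := by
    intro α x x₀ y hα hx₀ hy hlim f
    obtain ⟨F, hF⟩ := LimSymb.exists_isPrimitive (CuspFormClass.holo f)
    have := LimSymb.tendsto_sheetSymbol f hF g (x := x) (hmult m₀ l₀ hl₀)
      (LimSymb.mulVec_periodMatrix hβ horb₀)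
      (fun w => f.im_smul_sub_im hF hmem₀ w UpperHalfPlane.I) hα hx₀ hy hlim
    rw [LinearMap.smul_apply, LimSymb.arcClass_apply f hF, smul_eq_mul, mul_comm, ← div_eq_mul_inv]
    exact this
  refine ⟨_, _, hlyap, by positivity, hlimit, ⟨m₀, l₀, hl₀, hs₀⟩, fun m l hl hs f => ?_⟩
  obtain ⟨horb, hmem⟩ := (LimSymb.iterate_shift_eq_iff g β m l).mp hs
  obtain ⟨F, hF⟩ := LimSymb.exists_isPrimitive (CuspFormClass.holo f)
  have hlam := tendsto_nhds_unique hlyap (LimSymb.isLyapunovExponent_of_periodic hβ hl horb)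
  -- The class was built from one period `(m₀, l₀)`. Evaluating the limit along a single geodesic
  -- with the period `(m, l)` as well shows that both give the same value.
  obtain ⟨x₀, y, hx₀, hy, hlim⟩ := LimSymb.verticalGeodesic β
  have hα : (OnePoint.infty : OnePoint ℝ) ≠ (β : OnePoint ℝ) := OnePoint.infty_ne_coe β
  have h1 := hlimit _ x₀ x₀ y hα hx₀ hy hlim f
  have h2 := LimSymb.tendsto_sheetSymbol f hF g (x := x₀) (hmult m l hl)
    (LimSymb.mulVec_periodMatrix hβ horb)
    (fun w => f.im_smul_sub_im hF hmem w UpperHalfPlane.I) hα hx₀ hy hlim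
  have hl' : (l : ℝ) ≠ 0 := by exact_mod_cast hl.ne'
  rw [tendsto_nhds_unique h1 h2,
    LimSymb.sum_sheetSymbol_convergent f hF g hmem UpperHalfPlane.I, hlam, div_mul_cancel₀ _ hl']
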